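/- Let $d\ge 1$ and let $C([0,1]^d)$ be the space of continuous functions $f:[0,1]^d\to\mathbb R$ with the supremum metric. For $f\in C([0,1]^d)$ let $H_f\subset\mathbb R^{d}\times\mathbb R$ be the convex hull of the graph $\{(x,f(x)):x\in[0,1]^d\}$, and for $x\in[0,1]^d$ put $$\varphi_{1,f}(x)=\max\{y:(x,y)\in H_f\},\qquad \varphi_{2,f}(x)=\min\{y:(x,y)\in H_f\},\qquad E_{i,f}=\{x\in[0,1]^d:\varphi_{i,f}(x)=f(x)\}.$$ For a bounded function $\varphi:[0,1]^d\to\mathbb R$, a point $x\in[0,1]^d$ and $h\ge 0$, write $\varphi\in C^h_x$ if there are a polynomial $P$ in $d$ variables of degree at most $[h]$ (the integer part of $h$) and a constant $C$ such that $|\varphi(x')-P(x'-x)|\le C|x'-x|^h$ for all $x'\in[0,1]^d$ sufficiently close to $x$. The pointwise Hölder exponent is $h_\varphi(x)=\sup\{h\ge 0:\varphi\in C^h_x\}\in[0,+\infty]$; put $\mathbf E^h_\varphi=\{x\in[0,1]^d:h_\varphi(x)=h\}$ and $d_\varphi(h)=\dim_H\mathbf E^h_\varphi$, where $\dim_H$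 is the Hausdorff dimension, with $\dim_H\emptyset=-\infty$. For $j=1,\dots,d$ let $F_{0,j}=\{x\in[0,1]^d:x_j=0\}$ and $F_{1,j}=\{x\in[0,1]^d:x_j=1\}$, and let $\partial_{j,+}$, $\partial_{j,-}$ denote the right and left partial derivatives in the $j$-th variable (limits of difference quotients in $[-\infty,+\infty]$). There exists a dense $G_\delta$ set $\mathcal G\subseteq C([0,1]^d)$ such that for every $f\in\mathcal G$ and for $i=1,2$: - $\varphi_{i,f}$ is continuously differentiable on $(0,1)^d$; - $h_{\varphi_{i,f}}(x)=0$ for every $x\in\partial([0,1]^d)$; moreover $d_{\varphi_{i,f}}(0)=d-1$ and $\mathbf E^0_{\varphi_{i,f}}\cap(0,1)^d=\emptyset$; - $d_{\varphi_{i,f}}(1)=d-1$; - $d_{\varphi_{i,f}}(+\infty)=d$; - $d_{\varphi_{i,f}}(h)=-\infty$, that is, $\mathbf E^h_{\varphi_{i,f}}=\emptyset$, for every $h\in(0,+\infty)\setminus\{1\}$; - for every $j=1,\dots,d$: $\partial_{j,+}\varphi_{i,f}(x)=(-1)^{i+1}(+\infty)$ if $x\in F_{0,j}$, and $\partial_{j,-}\varphi_{i,f}(x)=(-1)^{i}(+\infty)$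 if $x\in F_{1,j}$; - $\dim_H E_{i,f}=0$. -/

import Mathlib

open Set Filter Topology
open scoped NNReal ENNReal

noncomputable section

namespace ConvexHullGraph

/-- The closed cube `[0,1]^d`, with the Euclidean metric. -/
def cube (d : ℕ) : Set (EuclideanSpace ℝ (Fin d)) :=
  {x | ∀ j, x j ∈ Icc (0 : ℝ) 1}

/-- The open cube `(0,1)^d`. -/
def openCube (d : ℕ) : Set (EuclideanSpace ℝ (Fin d)) :=
  {x | ∀ j, x j ∈ Ioo (0 : ℝ) 1}

/-- The face of `[0,1]^d` on which the `j`-th coordinate equals `a` (used for `a = 0, 1`). -/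
def face {d : ℕ} (a : ℝ) (j : Fin d) : Set (EuclideanSpace ℝ (Fin d)) :=
  {x | x ∈ cube d ∧ x j = a}

theorem isCompact_cube (d : ℕ) : IsCompact (cube d) := by
  have h : cube d = (EuclideanSpace.equiv (Fin d) ℝ).toHomeomorph ⁻¹'
      (Set.pi univ fun _ => Icc (0 : ℝ) 1) := by
    ext x
    simp only [cube, mem_ofPred_eq, mem_preimage, mem_univ_pi]
    exact Iff.rfl
  rw [h, Homeomorph.isCompact_preimage]
  exact isCompact_univ_pi fun _ => isCompact_Icc

/-- Compactness of the cube: `C(cube d, ℝ)` thereby carries the supremum metric, whose topology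
is the topology that Mathlib puts on `C(cube d, ℝ)`. -/
instance instCompactSpaceCube (d : ℕ) : CompactSpace (cube d) :=
  isCompact_iff_compactSpace.mp (isCompact_cube d)

/-- The convex hull `H_f` of the graph of `f`, a (compact) subset of `ℝ^d × ℝ`. -/
def graphHull {d : ℕ} (f : C(cube d, ℝ)) : Set (EuclideanSpace ℝ (Fin d) × ℝ) :=
  convexHull ℝ (range fun x : cube d => ((x : EuclideanSpace ℝ (Fin d)), f x))

/-- The function on the top (`i = 1`), `x ↦ max {y | (x, y) ∈ H_f}`, and on the bottom (`i = 2`),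
`x ↦ min {y | (x, y) ∈ H_f}`, of `H_f`. For `x` in the cube the extrema are attained; the values
outside the cube are irrelevant. -/
def envelope {d : ℕ} (i : ℕ) (f : C(cube d, ℝ)) (x : EuclideanSpace ℝ (Fin d)) : ℝ :=
  if i = 1 then sSup {y | (x, y) ∈ graphHull f} else sInf {y | (x, y) ∈ graphHull f}

/-- The set of the points of the cube at which `f` coincides with its `i`-th envelope. -/
def contactSet {d : ℕ} (i : ℕ) (f : C(cube d, ℝ)) : Set (EuclideanSpace ℝ (Fin d)) :=
  {x | ∃ hx : x ∈ cube d, envelope i f x = f ⟨x, hx⟩}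

/-- `φ ∈ C^h_x` for a function `φ` on the cube: `φ` agrees near `x`, within the cube, with a
polynomial of degree at most `[h]` in `y - x`, up to an error `O(|y - x|^h)`. -/
def MemHolderAt {d : ℕ} (φ : EuclideanSpace ℝ (Fin d) → ℝ) (h : ℝ≥0)
    (x : EuclideanSpace ℝ (Fin d)) : Prop :=
  ∃ P : MvPolynomial (Fin d) ℝ, P.totalDegree ≤ ⌊h⌋₊ ∧ ∃ C : ℝ,
    ∀ᶠ y in 𝓝[cube d] x,
      |φ y - MvPolynomial.eval (fun j => y j - x j) P| ≤ C * ‖y - x‖ ^ (h : ℝ)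

/-- The pointwise Hölder exponent `sup {h ≥ 0 | φ ∈ C^h_x}`, with values in `[0, ∞]`. -/
def holderExponent {d : ℕ} (φ : EuclideanSpace ℝ (Fin d) → ℝ)
    (x : EuclideanSpace ℝ (Fin d)) : ℝ≥0∞ :=
  sSup {e : ℝ≥0∞ | ∃ h : ℝ≥0, MemHolderAt φ h x ∧ e = (h : ℝ≥0∞)}

/-- The set of the points of the cube at which `φ` has Hölder exponent `h`. -/
def holderLevelSet {d : ℕ} (φ : EuclideanSpace ℝ (Fin d) → ℝ) (h : ℝ≥0∞) :
    Set (EuclideanSpace ℝ (Fin d)) :=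
  {x | x ∈ cube d ∧ holderExponent φ x = h}

open Classical in
/-- Hausdorff dimension with the convention that the empty set has dimension `-∞`. -/
def hausdorffDim {d : ℕ} (s : Set (EuclideanSpace ℝ (Fin d))) : EReal :=
  if s = ∅ then ⊥ else ((dimH s : ℝ≥0∞) : EReal)

/-- The singularity spectrum of a function on the cube. -/
def spectrumHolder {d : ℕ} (φ : EuclideanSpace ℝ (Fin d) → ℝ) (h : ℝ≥0∞) : EReal :=
  hausdorffDim (holderLevelSet φ h)

/-- The right-hand `j`-th partial derivative of `φ` at `x` exists in `[-∞, ∞]` and equals `L`. -/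
def HasRightPartial {d : ℕ} (φ : EuclideanSpace ℝ (Fin d) → ℝ) (j : Fin d)
    (x : EuclideanSpace ℝ (Fin d)) (L : EReal) : Prop :=
  Tendsto (fun t : ℝ => (((φ (x + t • EuclideanSpace.single j (1 : ℝ)) - φ x) / t : ℝ) : EReal))
    (𝓝[>] 0) (𝓝 L)

/-- The left-hand `j`-th partial derivative of `φ` at `x` exists in `[-∞, ∞]` and equals `L`. -/
def HasLeftPartial {d : ℕ} (φ : EuclideanSpace ℝ (Fin d) → ℝ) (j : Fin d)
    (x : EuclideanSpace ℝ (Fin d)) (L : EReal) : Prop :=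
  Tendsto (fun t : ℝ => (((φ (x + t • EuclideanSpace.single j (1 : ℝ)) - φ x) / t : ℝ) : EReal))
    (𝓝[<] 0) (𝓝 L)

end ConvexHullGraph

end

/-!
The upper envelope of `f` is its least concave majorant, and the lower envelope is minus the upper
envelope of `-f`, so it suffices to study the upper envelope of a typical `f`.

* A small perturbation makes `f` rise arbitrarily steeply away from the faces of the cube, so a
  typical `f` does so at arbitrarily small scales. By concavity the inner one-sided derivatives of
  the envelope are then infinite on the boundary, and the exponent there is `0`. Moreover no
  supporting hyperplane over an interior point touches the graph of `f` over the boundary.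
* If the envelope is not differentiable at an interior point, two distinct hyperplanes support it
  there, and `f` lies under the resulting wedge and touches it at some contact point. A typical `f`
  admits no such wedge: the quadratic sup-convolutions, whose second differences are bounded below,
  are dense. Hence the envelope is differentiable inside the cube, and `C^1` by concavity.
* An interior point is a convex combination of contact points of one supporting hyperplane. If it
  is interior to their convex hull, the envelope is affine near it and the exponent is `∞`.
  Otherwise Carathéodory's theorem represents it by `d` contact points, and it is a ridge point.
  The contact set of a typical `f` has dimension `0`, so the ridge points, which are covered by
  `(d-1)`-simplices with vertices in that set, have dimension at most `d - 1`.
* A polyhedral function in general position which has a supporting hyperplane through `d` given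
  nodes has another one, obtained by tilting the first about these nodes. So its envelope bends
  across the simplex they span, and that of a typical `f` has very negative second differences near
  the ridge points at arbitrarily small scales. This gives exponent at most `1` there.
* On each segment entering the cube from a face the envelope has infinite slope at the face, so it
  is not affine: every such segment meets a ridge point, and the ridge points project onto
  `(0,1)^(d-1)`.
-/

noncomputable section

namespace ConvexHullGraph

/-- The Euclidean space containing the cube. -/
abbrev Space (d : ℕ) := EuclideanSpace ℝ (Fin d)

section ConvexCombinations

theorem sum_mul_add_const {ι : Type*} [Fintype ι] {w : ι → ℝ} (h1 : ∑ i, w i = 1)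
    (F : ι → ℝ) (c : ℝ) : ∑ i, w i * (F i + c) = ∑ i, w i * F i + c := by
  simp only [mul_add, Finset.sum_add_distrib, ← Finset.sum_mul, h1, one_mul]

theorem sum_mul_inner_add_const {ι E : Type*} [Fintype ι] [NormedAddCommGroup E]
    [InnerProductSpace ℝ E] {w : ι → ℝ} (h1 : ∑ i, w i = 1) (z : ι → E) (p : E) (c : ℝ) :
    ∑ i, w i * (inner ℝ p (z i) + c) = inner ℝ p (∑ i, w i • z i) + c := by
  rw [sum_mul_add_const h1, inner_sum]
  simp only [real_inner_smul_right]

theorem eq_of_sum_mul_eq_sum_mul {ι : Type*} [Fintype ι] {w F G : ι → ℝ} (hw : ∀ i, 0 < w i)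
    (hFG : ∀ i, F i ≤ G i) (h : ∑ i, w i * F i = ∑ i, w i * G i) (i : ι) : F i = G i := by
  rw [Finset.sum_eq_sum_iff_of_le fun i _ => mul_le_mul_of_nonneg_left (hFG i) (hw i).le] at h
  exact mul_left_cancel₀ (hw i).ne' (h i (Finset.mem_univ i))

theorem exists_fin_stdSimplex {ι V : Type*} [Fintype ι] [AddCommGroup V] [Module ℝ V] {N : ℕ}
    (hN : Fintype.card ι ≤ N) (z : ι → V) {w : ι → ℝ} (hw : w ∈ stdSimplex ℝ ι) :
    ∃ (z' : Fin N → V) (w' : Fin N → ℝ), w' ∈ stdSimplex ℝ (Fin N) ∧ (∀ k, z' k ∈ range z) ∧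
      ∑ k, w' k • z' k = ∑ i, w i • z i := by
  obtain ⟨i₀⟩ : Nonempty ι := not_isEmpty_iff.1 fun _ => by simpa using hw.2
  let e : Fin N ≃ ι ⊕ Fin (N - Fintype.card ι) := Fintype.equivOfCardEq (by simp [hN])
  refine ⟨Sum.elim z (fun _ => z i₀) ∘ e, Sum.elim w 0 ∘ e, ⟨fun k => ?_, ?_⟩, fun k => ?_, ?_⟩
  · rcases h : e k with i | j <;> simp [h, hw.1]
  · simpa [hw.2] using e.sum_comp (Sum.elim w 0)
  · rcases h : e k with i | j <;> simp [h]
  · simpa using e.sum_comp fun s => Sum.elim w 0 s • Sum.elim z (fun _ => z i₀) s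

theorem isCompact_convexHull {V : Type*} [NormedAddCommGroup V] [NormedSpace ℝ V]
    [FiniteDimensional ℝ V] {s : Set V} (hs : IsCompact s) : IsCompact (convexHull ℝ s) := by
  set N := Module.finrank ℝ V + 1
  have h : convexHull ℝ s = (fun p : (Fin N → ℝ) × (Fin N → V) => ∑ k, p.1 k • p.2 k) ''
      (stdSimplex ℝ (Fin N) ×ˢ Set.pi univ fun _ => s) := by
    ext x
    constructor
    · intro hx
      obtain ⟨ι, _, z, w, hz, hai, hw, h1, hsum⟩ := eq_pos_convex_span_of_mem_convexHull hx
      have hcard : Fintype.card ι ≤ N :=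
        hai.card_le_finrank_succ.trans (Nat.succ_le_succ (Submodule.finrank_le _))
      obtain ⟨z', w', hw', hz', hsum'⟩ := exists_fin_stdSimplex hcard z ⟨fun i => (hw i).le, h1⟩
      exact ⟨(w', z'), ⟨hw', fun k _ => hz (hz' k)⟩, hsum'.trans hsum⟩
    · rintro ⟨⟨w, z⟩, ⟨⟨hw, h1⟩, hz⟩, rfl⟩
      exact (convex_convexHull ℝ s).sum_mem (fun i _ => hw i) h1
        fun i _ => subset_convexHull ℝ s (hz i (mem_univ i))
  rw [h]
  refine ((isCompact_stdSimplex ℝ (Fin N)).prod (isCompact_univ_pi fun _ => hs)).image ?_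
  fun_prop

end ConvexCombinations

section Supergradient

theorem notMem_interior_hypograph {E : Type*} [TopologicalSpace E] {s : Set E} {φ : E → ℝ}
    {x : E} :
    (x, φ x) ∉ interior {q : E × ℝ | q.1 ∈ s ∧ q.2 ≤ φ q.1} := by
  intro h
  have hcont : Tendsto (fun t : ℝ => (x, φ x + t)) (𝓝[>] 0) (𝓝 (x, φ x)) :=
    tendsto_nhdsWithin_of_tendsto_nhds <| by
      simpa using (Continuous.tendsto (f := fun t : ℝ => (x, φ x + t)) (by fun_prop) 0)
  obtain ⟨t, ht, ht0⟩ :=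
    ((hcont.eventually (mem_interior_iff_mem_nhds.1 h)).and self_mem_nhdsWithin).exists
  exact (lt_add_of_pos_right (φ x) ht0).not_ge ht.2

variable {E : Type*} [NormedAddCommGroup E] [InnerProductSpace ℝ E] [FiniteDimensional ℝ E]
  {s : Set E} {φ : E → ℝ} {x : E}

theorem mem_interior_hypograph_sub_one (hφ : ConcaveOn ℝ s φ) (hx : x ∈ interior s) :
    (x, φ x - 1) ∈ interior {q : E × ℝ | q.1 ∈ s ∧ q.2 ≤ φ q.1} := by
  have hcont : ContinuousAt φ x :=
    hφ.continuousOn_interior.continuousAt (isOpen_interior.mem_nhds hx)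
  have hfst : ContinuousAt Prod.fst (x, φ x - 1) := continuous_fst.continuousAt
  have hlt : ∀ᶠ q : E × ℝ in 𝓝 (x, φ x - 1), q.2 < φ q.1 :=
    continuous_snd.continuousAt.eventually_lt (hcont.comp hfst) (sub_one_lt _)
  rw [mem_interior_iff_mem_nhds]
  filter_upwards [hfst.eventually (mem_interior_iff_mem_nhds.1 hx), hlt] with q hq hq'
  exact ⟨hq, hq'.le⟩

theorem exists_supergradient (hφ : ConcaveOn ℝ s φ) (hx : x ∈ interior s) :
    ∃ p : E, ∀ y ∈ s, φ y ≤ φ x + inner ℝ p (y - x) := by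
  obtain ⟨F, hF0, hF⟩ := geometric_hahn_banach_of_nonempty_interior_point hφ.convex_hypograph
    notMem_interior_hypograph ⟨_, mem_interior_hypograph_sub_one hφ hx⟩
  set G : E →L[ℝ] ℝ := F.comp (ContinuousLinearMap.inl ℝ E ℝ)
  set b := F (0, 1)
  have hsplit (y : E) (t : ℝ) : F (y, t) = G y + t * b := by
    have : (y, t) = (y, (0 : ℝ)) + t • ((0 : E), (1 : ℝ)) := by simp
    rw [this, map_add, map_smul, smul_eq_mul]
    rfl
  have hle : ∀ y ∈ s, G y + φ y * b ≤ G x + φ x * b := fun y hy => by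
    simpa only [hsplit] using hF (y, φ y) ⟨hy, le_rfl⟩
  have hb0 : 0 ≤ b := by
    have := hF (x, φ x - 1) ⟨interior_subset hx, (sub_one_lt _).le⟩
    rw [hsplit, hsplit] at this
    linarith
  -- A vertical supporting hyperplane is impossible: `G` would have a local maximum at `x`.
  have hb : b ≠ 0 := by
    intro hb
    have hmax : IsLocalMax G x := by
      filter_upwards [mem_interior_iff_mem_nhds.1 hx] with y hy
      simpa [hb] using hle y hy
    have hG : G = 0 := by simpa using hmax.fderiv_eq_zero
    exact hF0 (ContinuousLinearMap.ext fun q => by simp [hsplit q.1 q.2, hG, hb])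
  refine ⟨(InnerProductSpace.toDual ℝ E).symm (-b⁻¹ • G), fun y hy => ?_⟩
  have : 0 < b := hb0.lt_of_ne' hb
  rw [InnerProductSpace.toDual_symm_apply, smul_apply, map_sub,
    smul_eq_mul, ← sub_nonneg]
  have : 0 ≤ b⁻¹ * (G x + φ x * b - (G y + φ y * b)) :=
    mul_nonneg (inv_nonneg.2 hb0) (sub_nonneg.2 (hle y hy))
  refine this.trans_eq ?_
  field_simp
  ring

end Supergradient

/-! ### The upper envelope -/

section Cube

variable {d : ℕ}

theorem convex_cube (d : ℕ) : Convex ℝ (cube d) := fun _ hx _ hy _ _ ha hb hab j =>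
  convex_Icc (0 : ℝ) 1 (hx j) (hy j) ha hb hab

theorem convex_openCube (d : ℕ) : Convex ℝ (openCube d) := fun _ hx _ hy _ _ ha hb hab j =>
  convex_Ioo (0 : ℝ) 1 (hx j) (hy j) ha hb hab

theorem isOpen_openCube (d : ℕ) : IsOpen (openCube d) := by
  simp only [openCube, ofPred_forall]
  exact isOpen_iInter_of_finite fun j => isOpen_Ioo.preimage (by fun_prop)

theorem openCube_subset_cube (d : ℕ) : openCube d ⊆ cube d := fun _ hx j =>
  Ioo_subset_Icc_self (hx j)

theorem openCube_subset_interior_cube (d : ℕ) : openCube d ⊆ interior (cube d) :=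
  interior_maximal (openCube_subset_cube d) (isOpen_openCube d)

theorem zero_mem_cube (d : ℕ) : (0 : Space d) ∈ cube d := fun _ => by simp

theorem norm_le_sum_abs (v : Space d) : ‖v‖ ≤ ∑ j, |v j| := by
  rw [EuclideanSpace.norm_eq]
  refine Real.sqrt_le_iff.2 ⟨Finset.sum_nonneg fun j _ => abs_nonneg _, ?_⟩
  simp only [Real.norm_eq_abs]
  exact Finset.sum_sq_le_sq_sum_of_nonneg fun j _ => abs_nonneg _

theorem norm_le_of_mem_cube {x : Space d} (hx : x ∈ cube d) : ‖x‖ ≤ d :=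
  calc ‖x‖ ≤ ∑ j, |x j| := norm_le_sum_abs x
    _ ≤ ∑ _j : Fin d, (1 : ℝ) := Finset.sum_le_sum fun j _ => by
        rw [abs_of_nonneg (hx j).1]; exact (hx j).2
    _ = d := by simp

theorem exists_mem_face_of_notMem_openCube {x : Space d} (hx : x ∈ cube d)
    (hx' : x ∉ openCube d) : ∃ j, ∃ a : ℝ, (a = 0 ∨ a = 1) ∧ x ∈ face a j := by
  simp only [openCube, mem_ofPred_eq, not_forall] at hx'
  obtain ⟨j, hj⟩ := hx'
  refine ⟨j, x j, ?_, hx, rfl⟩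
  rcases (hx j).1.eq_or_lt with h | h
  · exact Or.inl h.symm
  · exact Or.inr (le_antisymm (hx j).2 (not_lt.1 fun h' => hj ⟨h, h'⟩))

theorem frontier_cube_subset (d : ℕ) : frontier (cube d) ⊆ cube d \ openCube d := by
  rw [(isCompact_cube d).isClosed.frontier_eq]
  exact sdiff_subset_sdiff_right (openCube_subset_interior_cube d)

theorem exists_closedBall_subset_cube {x : Space d} (hx : x ∈ openCube d) :
    ∃ r > 0, Metric.closedBall x r ⊆ cube d :=
  Metric.nhds_basis_closedBall.mem_iff.1
    (mem_interior_iff_mem_nhds.1 (openCube_subset_interior_cube d hx))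

end Cube

section Envelope

variable {d : ℕ} {f g : C(cube d, ℝ)} {x : Space d}

theorem isCompact_graphHull (f : C(cube d, ℝ)) : IsCompact (graphHull f) :=
  isCompact_convexHull (isCompact_range (by fun_prop))

theorem isCompact_graphHull_fiber (f : C(cube d, ℝ)) (x : Space d) :
    IsCompact {y : ℝ | (x, y) ∈ graphHull f} :=
  (Topology.IsClosedEmbedding.of_continuous_injective_isClosedMap (f := fun y : ℝ => (x, y))
    (by fun_prop) (Prod.mk_right_injective x)
    (isClosedMap_prodMk_left x)).isCompact_preimage (isCompact_graphHull f)

theorem mk_mem_graphHull (f : C(cube d, ℝ)) (x : cube d) : ((x : Space d), f x) ∈ graphHull f :=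
  subset_convexHull ℝ _ (mem_range_self x)

theorem envelope_one (f : C(cube d, ℝ)) (x : Space d) :
    envelope 1 f x = sSup {y | (x, y) ∈ graphHull f} := if_pos rfl

theorem le_envelope_of_mem_graphHull {y : ℝ} (h : (x, y) ∈ graphHull f) :
    y ≤ envelope 1 f x := by
  rw [envelope_one]
  exact le_csSup (isCompact_graphHull_fiber f x).bddAbove h

theorem mk_envelope_mem_graphHull (f : C(cube d, ℝ)) (hx : x ∈ cube d) :
    (x, envelope 1 f x) ∈ graphHull f := by
  rw [envelope_one]
  exact (isCompact_graphHull_fiber f x).sSup_mem ⟨_, mk_mem_graphHull f ⟨x, hx⟩⟩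

theorem le_envelope (f : C(cube d, ℝ)) (x : cube d) : f x ≤ envelope 1 f x :=
  le_envelope_of_mem_graphHull (mk_mem_graphHull f x)

theorem concaveOn_envelope (f : C(cube d, ℝ)) : ConcaveOn ℝ (cube d) (envelope 1 f) :=
  ⟨convex_cube d, fun _ hx _ hy _ _ ha hb hab => le_envelope_of_mem_graphHull <|
    convex_convexHull ℝ _ (mk_envelope_mem_graphHull f hx) (mk_envelope_mem_graphHull f hy)
      ha hb hab⟩

theorem envelope_le_of_concaveOn {φ : Space d → ℝ} (hφ : ConcaveOn ℝ (cube d) φ)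
    (h : ∀ y : cube d, f y ≤ φ y) (hx : x ∈ cube d) : envelope 1 f x ≤ φ x := by
  have hsub : graphHull f ⊆ {q | q.1 ∈ cube d ∧ q.2 ≤ φ q.1} := by
    refine convexHull_min ?_ hφ.convex_hypograph
    rintro _ ⟨y, rfl⟩
    exact ⟨y.2, h y⟩
  exact (hsub (mk_envelope_mem_graphHull f hx)).2

theorem envelope_le_envelope_add {c : ℝ} (h : ∀ y, f y ≤ g y + c) (hx : x ∈ cube d) :
    envelope 1 f x ≤ envelope 1 g x + c :=
  envelope_le_of_concaveOn (φ := fun y => envelope 1 g y + c)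
    ((concaveOn_envelope g).add_const c)
    (fun y => (h y).trans (by gcongr; exact le_envelope g y)) hx

theorem abs_envelope_sub_le {η : ℝ} (h : ∀ y, |f y - g y| ≤ η) (hx : x ∈ cube d) :
    |envelope 1 f x - envelope 1 g x| ≤ η := by
  have hfg := envelope_le_envelope_add (f := f) (g := g) (c := η)
    (fun y => by linarith [(abs_le.1 (h y)).2]) hx
  have hgf := envelope_le_envelope_add (f := g) (g := f) (c := η)
    (fun y => by linarith [(abs_le.1 (h y)).1]) hx
  rw [abs_le]
  constructor <;> linarith

theorem abs_envelope_le {M : ℝ} (h : ∀ y, |f y| ≤ M) (hx : x ∈ cube d) :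
    |envelope 1 f x| ≤ M :=
  abs_le.2 ⟨((abs_le.1 (h ⟨x, hx⟩)).1).trans (le_envelope f ⟨x, hx⟩),
    envelope_le_of_concaveOn (φ := fun _ => M) (concaveOn_const M (convex_cube d))
      (fun y => (abs_le.1 (h y)).2) hx⟩

theorem sum_le_envelope {ι : Type*} [Fintype ι] {w : ι → ℝ} {z : ι → cube d}
    (hw : w ∈ stdSimplex ℝ ι) : ∑ i, w i * f (z i) ≤ envelope 1 f (∑ i, w i • (z i : Space d)) :=
  calc ∑ i, w i * f (z i) ≤ ∑ i, w i • envelope 1 f (z i) :=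
        Finset.sum_le_sum fun i _ => mul_le_mul_of_nonneg_left (le_envelope f _) (hw.1 i)
    _ ≤ _ := (concaveOn_envelope f).le_map_sum (fun i _ => hw.1 i) hw.2 fun i _ => (z i).2

theorem exists_sum_eq_envelope (f : C(cube d, ℝ)) (hx : x ∈ cube d) :
    ∃ (ι : Type) (_ : Fintype ι) (w : ι → ℝ) (z : ι → cube d), w ∈ stdSimplex ℝ ι ∧
      (∀ i, 0 < w i) ∧ ∑ i, w i • (z i : Space d) = x ∧ ∑ i, w i * f (z i) = envelope 1 f x := by
  obtain ⟨ι, _, q, w, hq, -, hw, h1, hsum⟩ :=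
    eq_pos_convex_span_of_mem_convexHull (mk_envelope_mem_graphHull f hx)
  choose z hz using fun i => hq (mem_range_self i)
  refine ⟨ι, inferInstance, w, z, ⟨fun i => (hw i).le, h1⟩, hw, ?_, ?_⟩
  · simpa [Prod.fst_sum, ← hz] using congrArg Prod.fst hsum
  · simpa [Prod.snd_sum, ← hz] using congrArg Prod.snd hsum

end Envelope

section Majorants

variable {d : ℕ} {f : C(cube d, ℝ)} {x p : Space d} {c : ℝ}

/-- The affine function `y ↦ ⟪p, y⟫ + c` majorizes `f` on the cube. -/
def Majorizes (p : Space d) (c : ℝ) (f : C(cube d, ℝ)) : Prop :=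
  ∀ y : cube d, f y ≤ inner ℝ p (y : Space d) + c

theorem Majorizes.envelope_le (h : Majorizes p c f) (hx : x ∈ cube d) :
    envelope 1 f x ≤ inner ℝ p x + c :=
  envelope_le_of_concaveOn (φ := fun y => inner ℝ p y + c)
    (((innerₛₗ ℝ p).concaveOn (convex_cube d)).add_const c) h hx

theorem Majorizes.mem_contactSet (h : Majorizes p c f) {z : cube d}
    (hz : f z = inner ℝ p (z : Space d) + c) : (z : Space d) ∈ contactSet 1 f :=
  ⟨z.2, le_antisymm ((h.envelope_le z.2).trans hz.ge) (le_envelope f z)⟩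

theorem Majorizes.eq_of_sum_eq (h : Majorizes p c f) {ι : Type*} [Fintype ι] {w : ι → ℝ}
    {z : ι → cube d} (hw : ∀ i, 0 < w i) (h1 : ∑ i, w i = 1)
    (hsum : ∑ i, w i * f (z i) = inner ℝ p (∑ i, w i • (z i : Space d)) + c) (i : ι) :
    f (z i) = inner ℝ p (z i : Space d) + c := by
  rw [← sum_mul_inner_add_const h1] at hsum
  exact eq_of_sum_mul_eq_sum_mul hw (fun i => h (z i)) hsum i

theorem exists_touching_points (f : C(cube d, ℝ)) (hx : x ∈ cube d) :
    ∃ (ι : Type) (_ : Fintype ι) (w : ι → ℝ) (z : ι → cube d), w ∈ stdSimplex ℝ ι ∧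
      ∑ i, w i • (z i : Space d) = x ∧ ∀ p c, Majorizes p c f → envelope 1 f x = inner ℝ p x + c →
        ∀ i, f (z i) = inner ℝ p (z i : Space d) + c := by
  obtain ⟨ι, _, w, z, hw, hwpos, rfl, hval⟩ := exists_sum_eq_envelope f hx
  exact ⟨ι, inferInstance, w, z, hw, rfl, fun p c h hpc =>
    h.eq_of_sum_eq hwpos hw.2 (hval.trans hpc)⟩

theorem majorizes_of_supergradient
    (hp : ∀ y ∈ cube d, envelope 1 f y ≤ envelope 1 f x + inner ℝ p (y - x)) :
    Majorizes p (envelope 1 f x - inner ℝ p x) f := fun y => by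
  have := (le_envelope f y).trans (hp y y.2)
  rw [inner_sub_right] at this
  linarith

theorem exists_majorizes_envelope_eq (f : C(cube d, ℝ)) (hx : x ∈ openCube d) :
    ∃ p c, Majorizes p c f ∧ envelope 1 f x = inner ℝ p x + c := by
  obtain ⟨p, hp⟩ := exists_supergradient (concaveOn_envelope f) (openCube_subset_interior_cube d hx)
  exact ⟨p, _, majorizes_of_supergradient hp, by ring⟩

theorem Majorizes.norm_le (h : Majorizes p c f) {M r : ℝ} (hr : 0 < r) (hM : ∀ y, |f y| ≤ M)
    (hx : Metric.closedBall x r ⊆ cube d) (hval : inner ℝ p x + c ≤ M) : ‖p‖ ≤ 2 * M / r := by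
  rcases eq_or_ne p 0 with rfl | hp
  · have : 0 ≤ M := (abs_nonneg _).trans (hM ⟨0, zero_mem_cube d⟩)
    rw [norm_zero]
    positivity
  have hp' : 0 < ‖p‖ := norm_pos_iff.2 hp
  have hy : x - (r / ‖p‖) • p ∈ cube d := hx <| by
    rw [Metric.mem_closedBall, dist_eq_norm, sub_sub_cancel_left, norm_neg, norm_smul,
      Real.norm_of_nonneg (by positivity), div_mul_cancel₀ _ hp'.ne']
  have hle : f ⟨_, hy⟩ ≤ inner ℝ p x - r * ‖p‖ + c := by
    refine (h ⟨_, hy⟩).trans_eq ?_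
    rw [inner_sub_right, real_inner_smul_right, real_inner_self_eq_norm_sq]
    field_simp
  rw [le_div_iff₀ hr]
  linarith [(abs_le.1 (hM ⟨_, hy⟩)).1]

end Majorants

/-! ### Residual sets of continuous functions -/

section Residual

theorem mem_residual_of_exists_ball {X : Type*} [PseudoMetricSpace X] {S : Set X}
    (h : ∀ x, ∀ ε > 0, ∃ y, dist y x < ε ∧ ∃ η > 0, Metric.ball y η ⊆ S) : S ∈ residual X := by
  refine mem_of_superset (residual_of_dense_open isOpen_interior ?_) interior_subset
  rw [Metric.dense_iff]
  intro x ε hε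
  obtain ⟨y, hy, η, hη, hS⟩ := h x ε hε
  exact ⟨y, hy, mem_interior.2 ⟨_, hS, Metric.isOpen_ball, Metric.mem_ball_self hη⟩⟩

theorem eventually_mul_rpow_lt {s : ℝ} (hs : 0 < s) (N : ℝ) {ε : ℝ} (hε : 0 < ε) :
    ∀ᶠ δ in 𝓝[>] (0 : ℝ), N * δ ^ s < ε := by
  have h : Tendsto (fun δ : ℝ => N * δ ^ s) (𝓝[>] 0) (𝓝 (N * 0 ^ s)) :=
    (((Real.continuousAt_rpow_const 0 s (Or.inr hs.le)).tendsto).const_mul N).mono_left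
      nhdsWithin_le_nhds
  rw [Real.zero_rpow hs.ne', mul_zero] at h
  exact h.eventually_lt_const hε

theorem abs_sub_le_of_mem_ball {X : Type*} [TopologicalSpace X] [CompactSpace X] {f g : C(X, ℝ)}
    {η : ℝ} (h : f ∈ Metric.ball g η) (y : X) : |f y - g y| ≤ η :=
  (ContinuousMap.dist_apply_le_dist (f := f) (g := g) y).trans (Metric.mem_ball.1 h).le

end Residual

section Steepness

variable {d : ℕ} {f : C(cube d, ℝ)} {a t : ℝ} {j : Fin d} {x : Space d}

/-- The inward translation by `t` from the face of the cube on which the `j`-th coordinate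
is `a`, for `a = 0` or `a = 1`. -/
def inward (a : ℝ) (j : Fin d) (t : ℝ) (x : Space d) : Space d :=
  x + t • ((1 - 2 * a) • EuclideanSpace.single j (1 : ℝ))

theorem inward_apply_self (a : ℝ) (j : Fin d) (t : ℝ) (x : Space d) :
    inward a j t x j = x j + t * (1 - 2 * a) := by
  simp [inward]

theorem inward_mem_cube (ha : a = 0 ∨ a = 1) (ht : t ∈ Icc (0 : ℝ) 1) (hx : x ∈ face a j) :
    inward a j t x ∈ cube d := by
  intro k
  rcases eq_or_ne k j with rfl | hk
  · rw [inward_apply_self, hx.2]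
    rcases ha with rfl | rfl <;> constructor <;> linarith [ht.1, ht.2]
  · have hxk : inward a j t x k = x k := by simp [inward, hk]
    rw [hxk]
    exact hx.1 k

theorem norm_inward_sub (ha : a = 0 ∨ a = 1) (j : Fin d) (ht : 0 ≤ t) (x : Space d) :
    ‖inward a j t x - x‖ = t := by
  have : |1 - 2 * a| = 1 := by rcases ha with rfl | rfl <;> norm_num
  simp [inward, norm_smul, this, abs_of_nonneg ht]

theorem mem_face_of_sum_mem_face (ha : a = 0 ∨ a = 1) {ι : Type*} [Fintype ι] {w : ι → ℝ}
    {z : ι → cube d} (hw : ∀ i, 0 < w i) (h1 : ∑ i, w i = 1)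
    (hz : ∑ i, w i • (z i : Space d) ∈ face a j) (i : ι) : (z i : Space d) ∈ face a j := by
  have hj : ∑ i, w i * (z i : Space d) j = ∑ i, w i * a := by
    rw [← Finset.sum_mul, h1, one_mul]
    simpa using hz.2
  refine ⟨(z i).2, ?_⟩
  rcases ha with rfl | rfl
  · exact (eq_of_sum_mul_eq_sum_mul hw (fun i => ((z i).2 j).1) hj.symm i).symm
  · exact eq_of_sum_mul_eq_sum_mul hw (fun i => ((z i).2 j).2) hj i

theorem envelope_add_le_envelope_inward (ha : a = 0 ∨ a = 1) {k : ℝ} (ht : t ∈ Icc (0 : ℝ) 1)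
    (h : ∀ z z' : cube d, (z : Space d) ∈ face a j → (z' : Space d) = inward a j t z →
      f z + k ≤ f z') (hx : x ∈ face a j) :
    envelope 1 f x + k ≤ envelope 1 f (inward a j t x) := by
  obtain ⟨ι, _, w, z, hw, hwpos, rfl, hval⟩ := exists_sum_eq_envelope f hx.1
  have hface := mem_face_of_sum_mem_face ha hwpos hw.2 hx
  let z' : ι → cube d := fun i => ⟨inward a j t (z i), inward_mem_cube ha ht (hface i)⟩
  have hz' : ∑ i, w i • (z' i : Space d) = inward a j t (∑ i, w i • (z i : Space d)) := by
    simp only [z', inward, smul_add, Finset.sum_add_distrib, ← Finset.sum_smul, hw.2, one_smul]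
  calc envelope 1 f _ + k = ∑ i, w i * (f (z i) + k) := by rw [sum_mul_add_const hw.2, hval]
    _ ≤ ∑ i, w i * f (z' i) := Finset.sum_le_sum fun i _ =>
        mul_le_mul_of_nonneg_left (h _ _ (hface i) rfl) (hw.1 i)
    _ ≤ _ := hz' ▸ sum_le_envelope hw

/-- Along the face where the `j`-th coordinate is `a`, the upper envelope of `f` increases, at
some small scale `δ`, by more than `(n + 1) δ ^ (1 / (n + 1))`. -/
def SteepAlong (a : ℝ) (j : Fin d) (n : ℕ) (f : C(cube d, ℝ)) : Prop :=
  ∃ δ : ℝ, 0 < δ ∧ δ < 1 / (n + 1) ∧ ∀ x ∈ face a j,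
    (n + 1) * δ ^ (1 / ((n : ℝ) + 1)) < envelope 1 f (inward a j δ x) - envelope 1 f x

/-- `f` raised by `K`, except for a steep descent to `f` in the layer of width `δ` along the
face on which the `j`-th coordinate equals `a`. -/
def raiseOffFace (K δ a : ℝ) (j : Fin d) (f : C(cube d, ℝ)) : C(cube d, ℝ) :=
  ⟨fun x => f x + K * min (|(x : Space d) j - a| / δ) 1, by fun_prop⟩

theorem raiseOffFace_of_mem_face {K δ : ℝ} {z : cube d} (hz : (z : Space d) ∈ face a j) :
    raiseOffFace K δ a j f z = f z := by
  simp [raiseOffFace, hz.2]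

theorem raiseOffFace_of_eq_inward {K δ : ℝ} (ha : a = 0 ∨ a = 1) (hδ : 0 < δ) {z z' : cube d}
    (hz : (z : Space d) ∈ face a j) (hz' : (z' : Space d) = inward a j δ z) :
    raiseOffFace K δ a j f z' = f z' + K := by
  have hdist : |(z' : Space d) j - a| = δ := by
    rw [hz', inward_apply_self, hz.2, add_sub_cancel_left]
    rcases ha with rfl | rfl <;> norm_num [abs_of_pos hδ]
  simp [raiseOffFace, hdist, hδ.ne']

theorem dist_raiseOffFace_le {K δ : ℝ} (hK : 0 ≤ K) (hδ : 0 < δ) :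
    dist (raiseOffFace K δ a j f) f ≤ K := by
  rw [ContinuousMap.dist_le hK]
  intro x
  have h0 : 0 ≤ min (|(x : Space d) j - a| / δ) 1 := by positivity
  simpa [raiseOffFace, Real.dist_eq, abs_of_nonneg hK, abs_of_nonneg h0] using
    mul_le_of_le_one_right hK (min_le_right (|(x : Space d) j - a| / δ) 1)

theorem steepAlong_mem_residual (ha : a = 0 ∨ a = 1) (j : Fin d) (n : ℕ) :
    {f : C(cube d, ℝ) | SteepAlong a j n f} ∈ residual C(cube d, ℝ) := by
  refine mem_residual_of_exists_ball fun f ε hε => ?_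
  obtain ⟨δ₀, hδ₀, hmod⟩ := Metric.uniformContinuous_iff.1
    (CompactSpace.uniformContinuous_of_continuous f.continuous) (ε / 8) (by positivity)
  have hn : (0 : ℝ) < n + 1 := by positivity
  obtain ⟨δ, hδ, hδ0, hδmin⟩ := ((eventually_mul_rpow_lt (s := 1 / ((n : ℝ) + 1)) (by positivity)
    (n + 1) (ε := ε / 8) (by positivity)).and
      (Ioo_mem_nhdsGT (lt_min (one_div_pos.2 hn) hδ₀))).exists
  obtain ⟨hδn, hδδ₀⟩ := lt_min_iff.1 hδmin
  have hδ1 : δ ≤ 1 := hδn.le.trans (by rw [div_le_one hn]; linarith [n.cast_nonneg (α := ℝ)])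
  refine ⟨raiseOffFace (ε / 2) δ a j f,
    (dist_raiseOffFace_le (by positivity) hδ0).trans_lt (half_lt_self hε),
    ε / 32, by positivity, fun f' hf' => ⟨δ, hδ0, hδn, fun x hx => ?_⟩⟩
  have hjump : ∀ z z' : cube d, (z : Space d) ∈ face a j → (z' : Space d) = inward a j δ z →
      f' z + ε / 4 ≤ f' z' := by
    intro z z' hz hz'
    have hfz := abs_le.1 (abs_sub_le_of_mem_ball hf' z)
    have hfz' := abs_le.1 (abs_sub_le_of_mem_ball hf' z')
    rw [raiseOffFace_of_mem_face hz] at hfz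
    rw [raiseOffFace_of_eq_inward ha hδ0 hz hz'] at hfz'
    have hosc := hmod (a := z') (b := z) <| by
      rwa [Subtype.dist_eq, hz', dist_eq_norm, norm_inward_sub ha j hδ0.le]
    rw [Real.dist_eq, abs_lt] at hosc
    linarith [hosc.1, hfz.2, hfz'.1]
  linarith [envelope_add_le_envelope_inward ha ⟨hδ0.le, hδ1⟩ hjump hx]

end Steepness

section SupConvolution

variable {E : Type*} [NormedAddCommGroup E] {K : Set E} [CompactSpace K]

/-- The quadratic sup-convolution `x ↦ sup_y (f y - M ‖x - y‖²)` of a continuous function on a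
compact set. Its second differences are bounded below, and it is uniformly close to `f` for
large `M`. -/
def supConvolution (M : ℝ) (f : C(K, ℝ)) : C(K, ℝ) where
  toFun x := sSup ((fun y : K => f y - M * ‖(x : E) - y‖ ^ 2) '' univ)
  continuous_toFun := isCompact_univ.continuous_sSup <| by
    simp only [Function.HasUncurry.uncurry]
    fun_prop

theorem isCompact_image_sub_mul_norm_sq (M : ℝ) (f : C(K, ℝ)) (x : K) :
    IsCompact ((fun y : K => f y - M * ‖(x : E) - y‖ ^ 2) '' univ) :=
  isCompact_univ.image (by fun_prop)

theorem sub_mul_norm_sq_le_supConvolution (M : ℝ) (f : C(K, ℝ)) (x y : K) :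
    f y - M * ‖(x : E) - y‖ ^ 2 ≤ supConvolution M f x :=
  le_csSup (isCompact_image_sub_mul_norm_sq M f x).bddAbove (mem_image_of_mem _ (mem_univ y))

theorem exists_supConvolution_eq (M : ℝ) (f : C(K, ℝ)) (x : K) :
    ∃ y : K, supConvolution M f x = f y - M * ‖(x : E) - y‖ ^ 2 := by
  obtain ⟨y, -, hy⟩ :=
    (isCompact_image_sub_mul_norm_sq M f x).sSup_mem ⟨_, mem_image_of_mem _ (mem_univ x)⟩
  exact ⟨y, hy.symm⟩

theorem le_supConvolution (M : ℝ) (f : C(K, ℝ)) (x : K) : f x ≤ supConvolution M f x := by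
  simpa using sub_mul_norm_sq_le_supConvolution M f x x

theorem exists_dist_supConvolution_lt (f : C(K, ℝ)) {ε : ℝ} (hε : 0 < ε) :
    ∃ M > 0, dist (supConvolution M f) f < ε := by
  obtain ⟨δ, hδ, hmod⟩ := Metric.uniformContinuous_iff.1
    (CompactSpace.uniformContinuous_of_continuous f.continuous) (ε / 2) (half_pos hε)
  -- With this `M` the penalty `M δ²` exceeds the oscillation of `f`, so that the supremum is
  -- attained within distance `δ`.
  refine ⟨(2 * ‖f‖ + 1) / δ ^ 2, by positivity, ?_⟩
  set M := (2 * ‖f‖ + 1) / δ ^ 2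
  rw [ContinuousMap.dist_lt_iff hε]
  intro x
  obtain ⟨y, hy⟩ := exists_supConvolution_eq M f x
  have hge := le_supConvolution M f x
  have hpen : 0 ≤ M * ‖(x : E) - y‖ ^ 2 := by positivity
  have hxy : dist x y < δ := by
    rw [Subtype.dist_eq, dist_eq_norm]
    by_contra! h
    have hM : M * δ ^ 2 = 2 * ‖f‖ + 1 := div_mul_cancel₀ _ (by positivity)
    have : M * δ ^ 2 ≤ M * ‖(x : E) - y‖ ^ 2 := by gcongr
    linarith [(abs_le.1 (f.norm_coe_le_norm x)).1, (abs_le.1 (f.norm_coe_le_norm y)).2]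
  have hosc := hmod hxy
  rw [Real.dist_eq, abs_lt] at hosc
  rw [Real.dist_eq, abs_of_nonneg (by linarith)]
  linarith [hosc.1]

variable [InnerProductSpace ℝ E]

theorem le_supConvolution_add_sub (M : ℝ) (f : C(K, ℝ)) {a b m : K}
    (hm : (a : E) + b = (2 : ℝ) • (m : E)) :
    -(M / 2 * ‖(a : E) - b‖ ^ 2) ≤
      supConvolution M f a + supConvolution M f b - 2 * supConvolution M f m := by
  obtain ⟨y, hy⟩ := exists_supConvolution_eq M f m
  have ha := sub_mul_norm_sq_le_supConvolution M f a y
  have hb := sub_mul_norm_sq_le_supConvolution M f b y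
  have hpar := parallelogram_law_with_norm ℝ ((a : E) - y) ((b : E) - y)
  have hadd : (a : E) - y + (b - y) = (2 : ℝ) • ((m : E) - y) := by
    rw [smul_sub, ← hm, two_smul]
    abel
  rw [hadd, sub_sub_sub_cancel_right, norm_smul, Real.norm_ofNat] at hpar
  rw [hy]
  linear_combination ha + hb - M / 2 * hpar

/-- At some small scale the second differences of `f` are not too negative. -/
def WedgeFree (n : ℕ) (f : C(K, ℝ)) : Prop :=
  ∃ ρ : ℝ, 0 < ρ ∧ ρ < 1 / (n + 1) ∧ ∀ a b m : K, (a : E) + b = (2 : ℝ) • (m : E) →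
    ‖(a : E) - b‖ = 2 * ρ → -(ρ / (n + 1)) ≤ f a + f b - 2 * f m

theorem wedgeFree_mem_residual (n : ℕ) : {f : C(K, ℝ) | WedgeFree n f} ∈ residual C(K, ℝ) := by
  refine mem_residual_of_exists_ball fun f ε hε => ?_
  obtain ⟨M, hM, hg⟩ := exists_dist_supConvolution_lt f hε
  have hn : (0 : ℝ) < n + 1 := by positivity
  have hpos : 0 < 1 / (4 * M * (n + 1)) := by positivity
  obtain ⟨ρ, hρ0, hρ⟩ := exists_between (lt_min (one_div_pos.2 hn) hpos)
  obtain ⟨hρ1, hρ2⟩ := lt_min_iff.1 hρ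
  refine ⟨_, hg, ρ / (n + 1) / 8, by positivity, fun f' hf' => ⟨ρ, hρ0, hρ1, ?_⟩⟩
  intro a b m hm hnorm
  have hsc := le_supConvolution_add_sub M f hm
  have hpen : M / 2 * (2 * ρ) ^ 2 ≤ ρ / (n + 1) / 2 := by
    have : ρ * (4 * M * (n + 1)) ≤ 1 := ((lt_div_iff₀ (by positivity)).1 hρ2).le
    rw [div_div, le_div_iff₀ (by positivity)]
    linear_combination ρ * this
  rw [hnorm] at hsc
  linarith [(abs_le.1 (abs_sub_le_of_mem_ball hf' a)).1,
    (abs_le.1 (abs_sub_le_of_mem_ball hf' b)).1, (abs_le.1 (abs_sub_le_of_mem_ball hf' m)).2]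

end SupConvolution

section Hat

/-- The piecewise linear hat function, the basis function of linear interpolation. -/
def hat (t : ℝ) : ℝ := max 0 (1 - |t|)

theorem hat_nonneg (t : ℝ) : 0 ≤ hat t := le_max_left _ _

theorem hat_eq_zero {t : ℝ} (h : 1 ≤ |t|) : hat t = 0 := max_eq_left (by linarith)

theorem continuous_hat : Continuous hat := by
  unfold hat
  fun_prop

theorem hat_natCast_sub (k l : ℕ) : hat ((k : ℝ) - l) = if k = l then 1 else 0 := by
  split_ifs with h
  · simp [h, hat]
  · have : (1 : ℤ) ≤ |(k : ℤ) - l| := Int.one_le_abs (sub_ne_zero.2 (by exact_mod_cast h))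
    exact hat_eq_zero (by exact_mod_cast this)

theorem hat_eq_second_difference_abs (t : ℝ) : hat t = (|t + 1| + |t - 1| - 2 * |t|) / 2 := by
  unfold hat
  grind

theorem sum_range_hat (N : ℕ) (t : ℝ) :
    ∑ k ∈ Finset.range (N + 1), hat (t - k) = (|t + 1| - |t| - |t - N| + |t - (N + 1)|) / 2 := by
  induction N with
  | zero => simp [hat_eq_second_difference_abs]; ring
  | succ N ih =>
    rw [Finset.sum_range_succ, ih, hat_eq_second_difference_abs]
    push_cast
    ring_nf

theorem sum_range_hat_mul (N : ℕ) (t : ℝ) :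
    ∑ k ∈ Finset.range (N + 1), hat (t - k) * k =
      (|t| - (N + 1) * |t - N| + N * |t - (N + 1)|) / 2 := by
  induction N with
  | zero => simp
  | succ N ih =>
    rw [Finset.sum_range_succ, ih, hat_eq_second_difference_abs]
    push_cast
    ring_nf

theorem sum_fin_hat {N : ℕ} {t : ℝ} (ht : t ∈ Icc (0 : ℝ) N) :
    ∑ k : Fin (N + 1), hat (t - (k : ℕ)) = 1 := by
  rw [← Finset.sum_range fun k : ℕ => hat (t - k), sum_range_hat, abs_of_nonneg ht.1,
    abs_of_nonneg (by linarith [ht.1]), abs_of_nonpos (sub_nonpos.2 ht.2),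
    abs_of_nonpos (by linarith [ht.2])]
  ring

theorem sum_fin_hat_mul {N : ℕ} {t : ℝ} (ht : t ∈ Icc (0 : ℝ) N) :
    ∑ k : Fin (N + 1), hat (t - (k : ℕ)) * (k : ℕ) = t := by
  rw [← Finset.sum_range fun k : ℕ => hat (t - k) * k, sum_range_hat_mul, abs_of_nonneg ht.1,
    abs_of_nonpos (sub_nonpos.2 ht.2), abs_of_nonpos (by linarith [ht.2])]
  ring

end Hat

section Grid

variable {d N : ℕ} {x : Space d}

/-- The points of the cube whose coordinates are multiples of `1 / N` (only the origin when
`N = 0`). -/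
def gridPoint (N : ℕ) (i : Fin d → Fin (N + 1)) : cube d :=
  ⟨WithLp.toLp 2 fun j => ((i j : ℕ) : ℝ) / N, fun j => ⟨by positivity,
    div_le_one_of_le₀ (by exact_mod_cast Nat.lt_succ_iff.1 (i j).2) N.cast_nonneg⟩⟩

/-- The weight of the node `gridPoint N i` at `x` in the multilinear interpolation on the grid. -/
def gridWeight (N : ℕ) (i : Fin d → Fin (N + 1)) (x : Space d) : ℝ :=
  ∏ j, hat (N * x j - (i j : ℕ))

theorem gridPoint_apply (i : Fin d → Fin (N + 1)) (j : Fin d) :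
    (gridPoint N i : Space d) j = ((i j : ℕ) : ℝ) / N := rfl

theorem gridPoint_injective (hN : N ≠ 0) : Function.Injective (gridPoint (d := d) N) := by
  intro i k hik
  funext j
  have h := congrArg (fun y : cube d => (y : Space d) j) hik
  simp only [gridPoint_apply] at h
  rw [div_left_inj' (by exact_mod_cast hN)] at h
  exact Fin.ext (by exact_mod_cast h)

theorem continuous_gridWeight (i : Fin d → Fin (N + 1)) : Continuous (gridWeight N i) :=
  continuous_finsetProd _ fun _ _ => continuous_hat.comp (by fun_prop)

theorem natCast_mul_mem_Icc (hx : x ∈ cube d) (j : Fin d) : (N : ℝ) * x j ∈ Icc (0 : ℝ) N :=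
  ⟨mul_nonneg N.cast_nonneg (hx j).1, mul_le_of_le_one_right N.cast_nonneg (hx j).2⟩

theorem sum_prod_fin {R : Type*} [CommSemiring R] (F : Fin d → Fin (N + 1) → R) :
    ∑ i : Fin d → Fin (N + 1), ∏ j, F j (i j) = ∏ j, ∑ k, F j k := by
  rw [Finset.prod_univ_sum, Fintype.piFinset_univ]

theorem gridWeight_mem_stdSimplex (hx : x ∈ cube d) :
    (fun i => gridWeight N i x) ∈ stdSimplex ℝ (Fin d → Fin (N + 1)) := by
  refine ⟨fun i => Finset.prod_nonneg fun j _ => hat_nonneg _, ?_⟩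
  simp only [gridWeight]
  rw [sum_prod_fin fun j k => hat (N * x j - (k : ℕ))]
  exact Finset.prod_eq_one fun j _ => sum_fin_hat (natCast_mul_mem_Icc hx j)

theorem sum_gridWeight_smul_gridPoint (hN : N ≠ 0) (hx : x ∈ cube d) :
    ∑ i, gridWeight N i x • (gridPoint N i : Space d) = x := by
  ext l
  have hprod : ∀ i : Fin d → Fin (N + 1), (gridWeight N i x • (gridPoint N i : Space d)) l =
      ∏ j, (hat (N * x j - (i j : ℕ)) * if j = l then ((i j : ℕ) : ℝ) / N else 1) := fun i => by
    rw [Finset.prod_mul_distrib, Finset.prod_ite_eq' Finset.univ l, if_pos (Finset.mem_univ l)]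
    rfl
  rw [WithLp.ofLp_sum, Finset.sum_apply, Finset.sum_congr rfl fun i _ => hprod i,
    sum_prod_fin fun j k => hat (N * x j - (k : ℕ)) * if j = l then ((k : ℕ) : ℝ) / N else 1,
    Finset.prod_eq_single_of_mem l (Finset.mem_univ l)]
  · simp only [if_true, ← mul_div_assoc, ← Finset.sum_div]
    rw [sum_fin_hat_mul (natCast_mul_mem_Icc hx l),
      mul_div_cancel_left₀ _ (by exact_mod_cast hN)]
  · intro j _ hj
    simp only [if_neg hj, mul_one]
    exact sum_fin_hat (natCast_mul_mem_Icc hx j)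

theorem gridWeight_gridPoint (hN : N ≠ 0) (i k : Fin d → Fin (N + 1)) :
    gridWeight N i (gridPoint N k) = if i = k then 1 else 0 := by
  have hN' : (N : ℝ) ≠ 0 := by exact_mod_cast hN
  simp only [gridWeight, gridPoint_apply, mul_div_cancel₀ _ hN', hat_natCast_sub]
  split_ifs with h
  · simp [h]
  · obtain ⟨j, hj⟩ := Function.ne_iff.1 h
    exact Finset.prod_eq_zero (Finset.mem_univ j) (if_neg fun h => hj (Fin.ext h.symm))

theorem dist_gridPoint_le (hN : N ≠ 0) {i : Fin d → Fin (N + 1)} (hi : gridWeight N i x ≠ 0) :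
    dist (gridPoint N i : Space d) x ≤ d / N := by
  have hN0 : (0 : ℝ) < N := by exact_mod_cast Nat.pos_of_ne_zero hN
  have hcoord : ∀ j, |((gridPoint N i : Space d) - x) j| ≤ 1 / N := fun j => by
    have hhat : |N * x j - (i j : ℕ)| < 1 := not_le.1 fun h =>
      Finset.prod_ne_zero_iff.1 hi j (Finset.mem_univ j) (hat_eq_zero h)
    rw [PiLp.sub_apply, gridPoint_apply, le_div_iff₀ hN0, ← abs_of_pos hN0, ← abs_mul,
      abs_of_pos hN0, sub_mul, div_mul_cancel₀ _ hN0.ne', abs_sub_comm, mul_comm]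
    exact hhat.le
  calc dist (gridPoint N i : Space d) x ≤ ∑ j, |((gridPoint N i : Space d) - x) j| :=
        (dist_eq_norm _ _).trans_le (norm_le_sum_abs _)
    _ ≤ ∑ _j : Fin d, 1 / (N : ℝ) := Finset.sum_le_sum fun j _ => hcoord j
    _ = d / N := by simp [div_eq_mul_inv]

/-- The multilinear interpolant of `f` on the grid, lowered away from the nodes by `κ` times the
truncated distance to them, so that its upper envelope is determined by its nodal values. -/
def sunkInterpolant (N : ℕ) (κ : ℝ) (f : C(cube d, ℝ)) : C(cube d, ℝ) where
  toFun x := ∑ i, gridWeight N i x * f (gridPoint N i) -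
    κ * min 1 (Metric.infDist x (range (gridPoint N)))
  continuous_toFun := by
    have := continuous_gridWeight (d := d) (N := N)
    have := Metric.continuous_infDist_pt (range (gridPoint (d := d) N))
    fun_prop

theorem sunkInterpolant_gridPoint (hN : N ≠ 0) (κ : ℝ) (f : C(cube d, ℝ))
    (k : Fin d → Fin (N + 1)) : sunkInterpolant N κ f (gridPoint N k) = f (gridPoint N k) := by
  simp [sunkInterpolant, gridWeight_gridPoint hN, Metric.infDist_zero_of_mem (mem_range_self k)]

theorem abs_sum_gridWeight_mul_sub_le (hN : N ≠ 0) {f : C(cube d, ℝ)} {c η : ℝ} (hx : x ∈ cube d)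
    (h : ∀ y : cube d, dist (y : Space d) x ≤ d / N → |f y - c| ≤ η) :
    |∑ i, gridWeight N i x * f (gridPoint N i) - c| ≤ η := by
  obtain ⟨hnonneg, hsum⟩ := gridWeight_mem_stdSimplex (N := N) hx
  calc |∑ i, gridWeight N i x * f (gridPoint N i) - c|
      = |∑ i, gridWeight N i x * (f (gridPoint N i) - c)| := by
        simp only [sub_eq_add_neg, sum_mul_add_const hsum]
    _ ≤ ∑ i, |gridWeight N i x * (f (gridPoint N i) - c)| := Finset.abs_sum_le_sum_abs _ _
    _ ≤ ∑ i, gridWeight N i x * η := by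
        refine Finset.sum_le_sum fun i _ => ?_
        rw [abs_mul, abs_of_nonneg (hnonneg i)]
        rcases eq_or_ne (gridWeight N i x) 0 with hi | hi
        · simp [hi]
        · exact mul_le_mul_of_nonneg_left (h _ (dist_gridPoint_le hN hi)) (hnonneg i)
    _ = η := by rw [← Finset.sum_mul, hsum, one_mul]

end Grid

section PolyhedralApproximation

variable {d : ℕ} {ι : Type*}

/-- Off the nodes `P`, the function `g` lies below the upper envelope of its nodal values, with a
gap of at least `κ` times the truncated distance to some node. -/
def GapBelowNodes [Fintype ι] (g : C(cube d, ℝ)) (P : ι → cube d) (κ : ℝ) : Prop :=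
  ∀ x : cube d, ∃ w ∈ stdSimplex ℝ ι, ∑ i, w i • (P i : Space d) = x ∧
    ∃ k, g x + κ * min 1 (dist x (P k)) ≤ ∑ i, w i * g (P i)

/-- The points of the graph of `g` over the nodes `P` are in general position: an affine function
only agrees with `g` at affinely independent nodes. -/
def NodesInGeneralPosition (g : C(cube d, ℝ)) (P : ι → cube d) : Prop :=
  ∀ S : Finset ι, (∃ (p : Space d) (c : ℝ), ∀ i ∈ S, g (P i) = inner ℝ p (P i : Space d) + c) →
    AffineIndependent ℝ fun i : S => (P i : Space d)

theorem gapBelowNodes_sunkInterpolant {N : ℕ} (hN : N ≠ 0) (κ : ℝ) (f : C(cube d, ℝ)) :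
    GapBelowNodes (sunkInterpolant N κ f) (gridPoint N) κ := by
  intro x
  refine ⟨_, gridWeight_mem_stdSimplex x.2, sum_gridWeight_smul_gridPoint hN x.2, ?_⟩
  obtain ⟨_, ⟨k, rfl⟩, hk⟩ := (finite_range (gridPoint (d := d) N)).isCompact.exists_infDist_eq_dist
    (range_nonempty _) x
  refine ⟨k, ?_⟩
  simp only [sunkInterpolant_gridPoint hN]
  simp [sunkInterpolant, hk]

theorem dense_setOf_sum_mul_ne_zero {X : Type*} [TopologicalSpace X] [CompactSpace X] [T2Space X]
    [Finite ι] {P : ι → X} (hP : Function.Injective P) {t : Finset ι} {w : ι → ℝ} {e : ι}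
    (he : e ∈ t) (hwe : w e ≠ 0) : Dense {f : C(X, ℝ) | ∑ i ∈ t, w i * f (P i) ≠ 0} := by
  let Λ : C(X, ℝ) →L[ℝ] ℝ := ∑ i ∈ t, w i • ContinuousMap.evalCLM ℝ (P i)
  have hΛ (f : C(X, ℝ)) : Λ f = ∑ i ∈ t, w i * f (P i) := by simp [Λ]
  have hker : {f : C(X, ℝ) | ∑ i ∈ t, w i * f (P i) ≠ 0} = (Λ.ker : Set C(X, ℝ))ᶜ := by
    ext f
    simp [hΛ]
  rw [hker, ← interior_eq_empty_iff_dense_compl, ← not_nonempty_iff_eq_empty]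
  intro hne
  obtain ⟨f, hf0, hf1, -⟩ := exists_continuous_zero_one_of_isClosed
    (toFinite (P '' {e}ᶜ)).isClosed (isClosed_singleton (x := P e)) (by
      rw [disjoint_singleton_right, hP.mem_set_image]
      simp)
  have hf : Λ f = 0 := by
    have : f ∈ Λ.ker := Submodule.eq_top_of_nonempty_interior' _ hne ▸ Submodule.mem_top
    exact this
  rw [hΛ, Finset.sum_eq_single_of_mem e he fun i _ hi => by
    rw [hf0 (mem_image_of_mem P hi), Pi.zero_apply, mul_zero], hf1 (mem_singleton _)] at hf
  exact hwe (by simpa using hf)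

theorem dense_nodesInGeneralPosition [Finite ι] {P : ι → cube d} (hP : Function.Injective P) :
    Dense {f : C(cube d, ℝ) | NodesInGeneralPosition f P} := by
  have := Fintype.ofFinite ι
  refine dense_of_mem_residual (X := C(cube d, ℝ)) ?_
  refine (eventually_countable_forall (ι := Finset ι)).2 fun S => ?_
  by_cases hS : AffineIndependent ℝ fun i : S => (P i : Space d)
  · exact Eventually.of_forall fun f _ => hS
  rw [affineIndependent_iff] at hS
  push Not at hS
  obtain ⟨t, w, hw0, hw1, e, he, hwe⟩ := hS
  -- An affine dependence among the nodes is inherited by the values of any affine function, while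
  -- the continuous functions which do not satisfy it form a dense open set.
  have hopen : IsOpen {f : C(cube d, ℝ) | ∑ i ∈ t, w i * f (P i) ≠ 0} :=
    isOpen_ne.preimage (by fun_prop)
  refine mem_of_superset (residual_of_dense_open hopen (dense_setOf_sum_mul_ne_zero
    (P := fun i : S => P i) (hP.comp Subtype.val_injective) he hwe)) ?_
  rintro f hf ⟨p, c, hpc⟩
  refine absurd ?_ hf
  calc ∑ i ∈ t, w i * f (P i) = ∑ i ∈ t, w i * (inner ℝ p (P i : Space d) + c) :=
        Finset.sum_congr rfl fun i _ => by rw [hpc i i.2]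
    _ = inner ℝ p (∑ i ∈ t, w i • (P i : Space d)) + (∑ i ∈ t, w i) * c := by
        simp only [mul_add, Finset.sum_add_distrib, Finset.sum_mul, inner_sum,
          real_inner_smul_right]
    _ = 0 := by rw [hw0, hw1, inner_zero_right, zero_mul, add_zero]

theorem exists_polyhedral_dist_lt (f : C(cube d, ℝ)) {ε : ℝ} (hε : 0 < ε) :
    ∃ (g : C(cube d, ℝ)) (N : ℕ), ∃ κ > 0, dist g f < ε ∧
      GapBelowNodes g (gridPoint N) κ ∧ NodesInGeneralPosition g (gridPoint N) := by
  obtain ⟨δ, hδ, hmod⟩ := Metric.uniformContinuous_iff.1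
    (CompactSpace.uniformContinuous_of_continuous f.continuous) (ε / 8) (by positivity)
  obtain ⟨N, hN⟩ := exists_nat_gt (d / δ)
  have hN0 : (0 : ℝ) < N := lt_of_le_of_lt (by positivity) hN
  have hN' : N ≠ 0 := by exact_mod_cast hN0.ne'
  obtain ⟨f₁, hf₁, hgen⟩ := Metric.dense_iff.1
    (dense_nodesInGeneralPosition (gridPoint_injective (d := d) hN')) f (ε / 8) (by positivity)
  refine ⟨sunkInterpolant N (ε / 4) f₁, N, ε / 4, by positivity, ?_,
    gapBelowNodes_sunkInterpolant hN' _ _, fun S => ?_⟩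
  · rw [ContinuousMap.dist_lt_iff hε]
    intro x
    have hinterp := abs_le.1 <| abs_sum_gridWeight_mul_sub_le hN' (f := f₁) (c := f x) (η := ε / 4)
      x.2 fun y hy => by
        have hyx : dist y x < δ := hy.trans_lt (by rwa [div_lt_comm₀ hN0 hδ])
        have := abs_sub_le_of_mem_ball hf₁ y
        have hosc := hmod hyx
        rw [Real.dist_eq] at hosc
        linarith [abs_sub_le (f₁ y) (f y) (f x)]
    have hmin0 : 0 ≤ min 1 (Metric.infDist x (range (gridPoint N))) :=
      le_min zero_le_one Metric.infDist_nonneg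
    have hmin1 : min 1 (Metric.infDist x (range (gridPoint N))) ≤ 1 := min_le_left _ _
    rw [Real.dist_eq, abs_lt]
    simp only [sunkInterpolant, ContinuousMap.coe_mk]
    constructor <;> nlinarith [hinterp.1, hinterp.2]
  · simp only [sunkInterpolant_gridPoint hN']
    exact hgen S

end PolyhedralApproximation

section SupportingNodes

variable {V : Type*} [NormedAddCommGroup V]

theorem exists_affineMap_nonneg_of_card_le [NormedSpace ℝ V] [FiniteDimensional ℝ V]
    {α : Type*} [Fintype α] (hα : Fintype.card α ≤ Module.finrank ℝ V) {s : Set V}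
    (hs : AffineIndependent ℝ fun x : s => (x : V)) {t : α → V} (ht : ∀ k, t k ∈ s) :
    ∃ a : V →ᵃ[ℝ] ℝ, (∃ v, a v ≠ 0) ∧ (∀ k, a (t k) = 0) ∧ ∀ x ∈ s, 0 ≤ a x := by
  obtain ⟨s', hss', hind, hspan⟩ := exists_subset_affineIndependent_affineSpan_eq_top hs
  have : Finite s' := finite_of_fin_dim_affineIndependent ℝ hind
  have := Fintype.ofFinite s'
  let B : AffineBasis s' ℝ V := ⟨fun x => x, hind, by simpa using hspan⟩
  obtain ⟨b, hb⟩ : ∃ b : s', ∀ k, t k ≠ b := by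
    by_contra! h
    have hsurj : Function.Surjective fun k => (⟨t k, hss' (ht k)⟩ : s') := fun b =>
      (h b).imp fun _ => Subtype.ext
    have hcard := Fintype.card_le_of_surjective _ hsurj
    rw [B.card_eq_finrank_add_one] at hcard
    lia
  have hcoord_self : B.coord b (b : V) = 1 := B.coord_apply_eq b
  have hcoord_ne (y : s') (hy : y ≠ b) : B.coord b (y : V) = 0 := B.coord_apply_ne hy.symm
  refine ⟨B.coord b, ⟨b, by simp [hcoord_self]⟩, fun k => ?_, fun x hx => ?_⟩
  · exact hcoord_ne ⟨t k, hss' (ht k)⟩ fun h => hb k (congrArg Subtype.val h)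
  · by_cases hxb : (⟨x, hss' hx⟩ : s') = b
    · obtain rfl : x = b := congrArg Subtype.val hxb
      exact hcoord_self ▸ zero_le_one
    · exact (hcoord_ne ⟨x, hss' hx⟩ hxb).ge

theorem exists_inner_add_eq_affineMap [InnerProductSpace ℝ V] [FiniteDimensional ℝ V]
    (a : V →ᵃ[ℝ] ℝ) : ∃ (q : V) (b : ℝ), ∀ y, a y = inner ℝ q y + b := by
  refine ⟨(InnerProductSpace.toDual ℝ V).symm a.linear.toContinuousLinearMap, a 0, fun y => ?_⟩
  rw [InnerProductSpace.toDual_symm_apply]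
  simpa using a.map_vadd 0 y

theorem eventually_forall_le_add_mul {ι : Type*} [Finite ι] {l u v : ι → ℝ} (h : ∀ i, l i ≤ u i)
    (hv : ∀ i, l i = u i → 0 ≤ v i) : ∀ᶠ τ in 𝓝[>] (0 : ℝ), ∀ i, l i ≤ u i + τ * v i := by
  rw [eventually_all]
  intro i
  rcases (h i).eq_or_lt with heq | hlt
  · filter_upwards [eventually_mem_nhdsWithin] with τ hτ
    exact heq.trans_le (le_add_of_nonneg_right (mul_nonneg (le_of_lt hτ) (hv i heq)))
  · have hlim : Tendsto (fun τ => u i + τ * v i) (𝓝[>] 0) (𝓝 (u i)) :=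
      (Continuous.tendsto' (by fun_prop) _ _ (by simp)).mono_left nhdsWithin_le_nhds
    exact (hlim.eventually_const_lt hlt).mono fun _ => le_of_lt

theorem eventually_forall_mem_exists_lt {X ι : Type*} [TopologicalSpace X] {K : Set X}
    (hK : IsCompact K) {F : ι → X → ℝ} (hF : ∀ i, Continuous (F i))
    (hpos : ∀ x ∈ K, ∃ i, 0 < F i x) : ∀ᶠ τ in 𝓝 (0 : ℝ), ∀ x ∈ K, ∃ i, τ < F i x := by
  refine hK.induction_on (p := fun s => ∀ᶠ τ in 𝓝 (0 : ℝ), ∀ x ∈ s, ∃ i, τ < F i x)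
    (by simp) (fun s t hst ht => ht.mono fun τ h x hx => h x (hst hx)) (fun s t hs ht => ?_) ?_
  · filter_upwards [hs, ht] with τ hsτ htτ x hx using hx.elim (hsτ x) (htτ x)
  · intro x hx
    obtain ⟨i, hi⟩ := hpos x hx
    refine ⟨{y | F i x / 2 < F i y}, mem_nhdsWithin_of_mem_nhds ?_, ?_⟩
    · exact (hF i).continuousAt.eventually_const_lt (half_lt_self hi)
    · filter_upwards [eventually_lt_nhds (half_pos hi)] with τ hτ y hy using ⟨i, hτ.trans hy⟩

theorem norm_sum_smul_sub_le [NormedSpace ℝ V] {α : Type*} [Fintype α] {w : α → ℝ}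
    (hw : w ∈ stdSimplex ℝ α) {y z : α → V} {r : ℝ} (h : ∀ k, ‖y k - z k‖ ≤ r) :
    ‖∑ k, w k • y k - ∑ k, w k • z k‖ ≤ r := by
  simp only [← Finset.sum_sub_distrib, ← smul_sub]
  simpa using (convex_closedBall (0 : V) r).sum_mem (fun k _ => hw.1 k) hw.2
    fun k _ => mem_closedBall_zero_iff.2 (h k)

variable {d : ℕ} {f g : C(cube d, ℝ)} {ι α : Type*} {P : ι → cube d} {T : α → ι} {p : Space d}
  {c τ κ η : ℝ}

/-- The affine function `y ↦ ⟪p, y⟫ + c` supports the values of `g` at the nodes `P`, up to an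
error `τ`, and touches them at the nodes selected by `T`. -/
def SupportsNodes (g : C(cube d, ℝ)) (P : ι → cube d) (T : α → ι) (τ : ℝ) (p : Space d) (c : ℝ) :
    Prop :=
  (∀ i, g (P i) ≤ inner ℝ p (P i : Space d) + c + τ) ∧
    ∀ k, inner ℝ p (P (T k) : Space d) + c ≤ g (P (T k)) + τ

theorem SupportsNodes.le (h : SupportsNodes g P T 0 p c) (i : ι) :
    g (P i) ≤ inner ℝ p (P i : Space d) + c := by
  simpa using h.1 i

theorem SupportsNodes.eq (h : SupportsNodes g P T 0 p c) (k : α) :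
    g (P (T k)) = inner ℝ p (P (T k) : Space d) + c :=
  (h.le _).antisymm (by simpa using h.2 k)

theorem NodesInGeneralPosition.exists_ne_supportsNodes [Finite ι] [Fintype α]
    (hgen : NodesInGeneralPosition g P) (hα : Fintype.card α ≤ d) [Nonempty α]
    (h : SupportsNodes g P T 0 p c) : ∃ p' c', p' ≠ p ∧ SupportsNodes g P T 0 p' c' := by
  classical
  have := Fintype.ofFinite ι
  let S : Finset ι := {i | g (P i) = inner ℝ p (P i : Space d) + c}
  have hS (i : ι) : i ∈ S ↔ g (P i) = inner ℝ p (P i : Space d) + c := by simp [S]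
  obtain ⟨a, ⟨v, hv⟩, haT, haS⟩ := exists_affineMap_nonneg_of_card_le
    (t := fun k => (P (T k) : Space d)) (by simpa using hα)
    (hgen S ⟨p, c, fun i hi => (hS i).1 hi⟩).range fun k => ⟨⟨T k, (hS _).2 (h.eq k)⟩, rfl⟩
  obtain ⟨q, b, ha⟩ := exists_inner_add_eq_affineMap a
  obtain ⟨τ, hτ, hτ0⟩ := ((eventually_forall_le_add_mul (v := fun i => a (P i)) h.le
    fun i hi => haS _ ⟨⟨i, (hS i).2 hi⟩, rfl⟩).and eventually_mem_nhdsWithin).exists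
  have hq : q ≠ 0 := by
    rintro rfl
    have hk := haT (Classical.arbitrary α)
    rw [ha, inner_zero_left] at hk hv
    exact hv hk
  have htilt (y : Space d) :
      inner ℝ (p + τ • q) y + (c + τ * b) = inner ℝ p y + c + τ * a y := by
    rw [ha, inner_add_left, real_inner_smul_left]
    ring
  refine ⟨p + τ • q, c + τ * b, by simpa [(ne_of_gt hτ0 : τ ≠ 0)] using hq, fun i => ?_,
    fun k => ?_⟩
  · simpa only [htilt, add_zero] using hτ i
  · simp only [htilt, haT, h.eq k, mul_zero, add_zero, le_refl]

/-- As soon as an affine function with coefficients at most `R` supports `g` at the nodes `T` up to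
an error `τ`, there are two exact supports at these nodes, of slopes at least `τ` apart. -/
def HasSeparatedSupports (g : C(cube d, ℝ)) (P : ι → cube d) (T : α → ι) (R τ : ℝ) : Prop :=
  ∀ (p : Space d) (c : ℝ), ‖p‖ ≤ R → |c| ≤ R → SupportsNodes g P T τ p c →
    ∃ p₁ c₁ p₂ c₂, τ ≤ ‖p₁ - p₂‖ ∧ SupportsNodes g P T 0 p₁ c₁ ∧ SupportsNodes g P T 0 p₂ c₂

theorem NodesInGeneralPosition.eventually_hasSeparatedSupports [Finite ι] [Fintype α]
    (hgen : NodesInGeneralPosition g P) (hα : Fintype.card α ≤ d) [Nonempty α] (T : α → ι)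
    (R : ℝ) : ∀ᶠ τ in 𝓝[>] (0 : ℝ), HasSeparatedSupports g P T R τ := by
  by_cases h : ∃ p c, SupportsNodes g P T 0 p c
  · obtain ⟨p, c, hpc⟩ := h
    obtain ⟨p', c', hne, hpc'⟩ := hgen.exists_ne_supportsNodes hα hpc
    filter_upwards [Ioo_mem_nhdsGT (norm_pos_iff.2 (sub_ne_zero.2 hne))] with τ hτ
    exact fun _ _ _ _ _ => ⟨p', c', p, c, hτ.2.le, hpc', hpc⟩
  · let F : ι ⊕ α → Space d × ℝ → ℝ := Sum.elim
      (fun i a => g (P i) - (inner ℝ a.1 (P i : Space d) + a.2))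
      fun k a => inner ℝ a.1 (P (T k) : Space d) + a.2 - g (P (T k))
    have hF : ∀ i, Continuous (F i) := by
      rintro (i | k) <;> simp only [F, Sum.elim_inl, Sum.elim_inr] <;> fun_prop
    have hpos (a : Space d × ℝ) : ∃ i, 0 < F i a := by
      by_contra! hle
      exact h ⟨a.1, a.2, fun i => by simpa [F] using hle (.inl i),
        fun k => by simpa [F] using hle (.inr k)⟩
    have hcompact := (isCompact_closedBall (0 : Space d) R).prod (isCompact_closedBall (0 : ℝ) R)
    filter_upwards [mem_nhdsWithin_of_mem_nhds
      (eventually_forall_mem_exists_lt hcompact hF fun a _ => hpos a)] with τ hτ p c hp hc hpc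
    obtain ⟨i | k, hi⟩ := hτ (p, c) ⟨by simpa using hp, by simpa using hc⟩
    · exact absurd (hpc.1 i) (not_le.2 (by linarith [show τ < g (P i) - _ from hi]))
    · exact absurd (hpc.2 k) (not_le.2 (by linarith [show τ < _ - g (P (T k)) from hi]))

theorem GapBelowNodes.majorizes [Fintype ι] (hgap : GapBelowNodes g P κ) (hκ : 0 ≤ κ)
    (h : ∀ i, g (P i) ≤ inner ℝ p (P i : Space d) + c) : Majorizes p c g := by
  intro y
  obtain ⟨w, hw, hsum, k, hk⟩ := hgap y
  calc g y ≤ g y + κ * min 1 (dist y (P k)) := le_add_of_nonneg_right (by positivity)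
    _ ≤ ∑ i, w i * g (P i) := hk
    _ ≤ ∑ i, w i * (inner ℝ p (P i : Space d) + c) :=
        Finset.sum_le_sum fun i _ => mul_le_mul_of_nonneg_left (h i) (hw.1 i)
    _ = inner ℝ p (y : Space d) + c := by rw [sum_mul_inner_add_const hw.2, hsum]

theorem GapBelowNodes.exists_dist_lt [Fintype ι] (hgap : GapBelowNodes g P κ) (hκ : 0 < κ) {r : ℝ}
    (hr : r ≤ 1) (hη : 2 * η < κ * r) (hf : ∀ y, |f y - g y| ≤ η) {x : cube d}
    (hx : (x : Space d) ∈ contactSet 1 f) : ∃ i, dist x (P i) < r := by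
  obtain ⟨_, hx⟩ := hx
  obtain ⟨w, hw, hsum, k, hk⟩ := hgap x
  have hnodes : ∑ i, w i * g (P i) ≤ ∑ i, w i * f (P i) + η := by
    rw [← sum_mul_add_const hw.2]
    exact Finset.sum_le_sum fun i _ =>
      mul_le_mul_of_nonneg_left (by linarith [(abs_le.1 (hf (P i))).1]) (hw.1 i)
  have henv : ∑ i, w i * f (P i) ≤ f x := by
    have := sum_le_envelope (f := f) (z := P) hw
    rwa [hsum, hx] at this
  have hmin : κ * min 1 (dist x (P k)) < κ * r := by linarith [(abs_le.1 (hf x)).2]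
  exact ⟨k, (min_lt_iff.1 (lt_of_mul_lt_mul_left hmin hκ.le)).resolve_left (not_lt.2 hr)⟩

theorem Majorizes.second_difference_le {p₁ p₂ : Space d} {c₁ c₂ : ℝ} {x v : Space d}
    (h₁ : Majorizes p₁ c₁ g) (h₂ : Majorizes p₂ c₂ g) (hx₁ : inner ℝ p₁ x + c₁ ≤ envelope 1 g x)
    (hx₂ : inner ℝ p₂ x + c₂ ≤ envelope 1 g x) (hadd : x + v ∈ cube d) (hsub : x - v ∈ cube d) :
    envelope 1 g (x + v) + envelope 1 g (x - v) - 2 * envelope 1 g x ≤ -inner ℝ (p₁ - p₂) v := by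
  have hadd' := h₂.envelope_le hadd
  have hsub' := h₁.envelope_le hsub
  rw [inner_add_right] at hadd'
  rw [inner_sub_right] at hsub'
  rw [inner_sub_left]
  linarith

theorem SupportsNodes.second_difference_le [Fintype ι] [Fintype α] (hgap : GapBelowNodes g P κ)
    (hκ : 0 ≤ κ) {p₁ p₂ : Space d} {c₁ c₂ : ℝ} (h₁ : SupportsNodes g P T 0 p₁ c₁)
    (h₂ : SupportsNodes g P T 0 p₂ c₂) {w : α → ℝ} (hw : w ∈ stdSimplex ℝ α) {x v : Space d}
    (hx : ∑ k, w k • (P (T k) : Space d) = x) (hadd : x + v ∈ cube d) (hsub : x - v ∈ cube d) :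
    envelope 1 g (x + v) + envelope 1 g (x - v) - 2 * envelope 1 g x ≤ -inner ℝ (p₁ - p₂) v := by
  have hle {p : Space d} {c : ℝ} (h : SupportsNodes g P T 0 p c) :
      inner ℝ p x + c ≤ envelope 1 g x := by
    rw [← hx, ← sum_mul_inner_add_const hw.2]
    simpa only [h.eq] using sum_le_envelope (f := g) (z := fun k => P (T k)) hw
  exact (hgap.majorizes hκ h₁.le).second_difference_le (hgap.majorizes hκ h₂.le) (hle h₁) (hle h₂)
    hadd hsub

end SupportingNodes

section Ridges

variable {d : ℕ} {f g : C(cube d, ℝ)} {x p : Space d} {c : ℝ}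

/-- `x` lies on the ridges of the upper envelope of `f`: it is a convex combination of only `d`
points of the cube at which an affine majorant of `f` touches `f`. -/
def IsRidgePoint (f : C(cube d, ℝ)) (x : Space d) : Prop :=
  ∃ (p : Space d) (c : ℝ) (z : Fin d → cube d), Majorizes p c f ∧
    (∀ k, f (z k) = inner ℝ p (z k : Space d) + c) ∧
    ∃ w ∈ stdSimplex ℝ (Fin d), ∑ k, w k • (z k : Space d) = x

/-- The contact set is covered by so few balls of the same small radius that its content in
dimension `1 / (n + 1)` is at most `1 / (n + 1)`. -/
def ThinContact (n : ℕ) (f : C(cube d, ℝ)) : Prop :=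
  ∃ (ι : Type) (_ : Fintype ι) (P : ι → cube d) (r : ℝ), 0 < r ∧ r < 1 / (n + 1) ∧
    (∀ x ∈ contactSet 1 f, ∃ i, dist x (P i) < r) ∧
    Fintype.card ι * r ^ (1 / ((n : ℝ) + 1)) ≤ 1 / (n + 1)

/-- At some small scale `ρ`, the upper envelope has a very negative second difference near every
ridge point that is not too close to the boundary. In the limit `n → ∞` this rules out a Hölder
exponent above `1` at the ridge points. -/
def SharpRidges (n : ℕ) (f : C(cube d, ℝ)) : Prop :=
  ∃ ρ : ℝ, 0 < ρ ∧ 2 * ρ < 1 / (n + 1) ∧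
    ∀ x, Metric.closedBall x (1 / ((n : ℝ) + 1)) ⊆ cube d → IsRidgePoint f x →
      ∃ z u : Space d, ‖z - x‖ ≤ ρ ∧ ‖u‖ = 1 ∧
        envelope 1 f (z + ρ • u) + envelope 1 f (z - ρ • u) - 2 * envelope 1 f z ≤
          -((n + 1) * ρ ^ (1 + 1 / ((n : ℝ) + 1)))

theorem Majorizes.envelope_sum_eq (h : Majorizes p c f) {ι : Type*} [Fintype ι] {w : ι → ℝ}
    {z : ι → cube d} (hw : w ∈ stdSimplex ℝ ι)
    (hz : ∀ k, f (z k) = inner ℝ p (z k : Space d) + c) :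
    envelope 1 f (∑ k, w k • (z k : Space d)) = inner ℝ p (∑ k, w k • (z k : Space d)) + c := by
  refine (h.envelope_le ?_).antisymm ?_
  · exact (convex_cube d).sum_mem (fun k _ => hw.1 k) hw.2 fun k _ => (z k).2
  · rw [← sum_mul_inner_add_const hw.2]
    simpa only [hz] using sum_le_envelope (f := f) (z := z) hw

theorem abs_const_le_of_abs_inner_add_le {M R : ℝ} (hx : x ∈ cube d) (hp : ‖p‖ ≤ R)
    (h : |inner ℝ p x + c| ≤ M) : |c| ≤ R * d + M := by
  have hpx : |inner ℝ p x| ≤ R * d := (abs_real_inner_le_norm p x).trans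
    (mul_le_mul hp (norm_le_of_mem_cube hx) (norm_nonneg x) ((norm_nonneg p).trans hp))
  calc |c| = |inner ℝ p x + c - inner ℝ p x| := by ring_nf
    _ ≤ |inner ℝ p x + c| + |inner ℝ p x| := abs_sub _ _
    _ ≤ R * d + M := by linarith

theorem IsRidgePoint.exists_supportsNodes {ι : Type*} {P : ι → cube d} {M r₀ R r τ : ℝ}
    (hridge : IsRidgePoint f x) (hr₀ : 0 < r₀) (hx : Metric.closedBall x r₀ ⊆ cube d)
    (hM : ∀ y, |f y| ≤ M) (hR : 2 * M / r₀ * (d + 1) + M ≤ R) (hRr : R * r ≤ τ / 4)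
    (hfg : ∀ y, |f y - g y| ≤ τ / 4) (hg : ∀ y z, dist y z < r → dist (g y) (g z) < τ / 4)
    (hcontact : ∀ z : cube d, (z : Space d) ∈ contactSet 1 f → ∃ i, dist z (P i) < r) :
    ∃ (p : Space d) (c : ℝ) (T : Fin d → ι), ‖p‖ ≤ R ∧ |c| ≤ R ∧ SupportsNodes g P T τ p c ∧
      ∃ w ∈ stdSimplex ℝ (Fin d), ‖∑ k, w k • (P (T k) : Space d) - x‖ ≤ r := by
  obtain ⟨p, c, z, hmaj, hz, w, hw, rfl⟩ := hridge
  have hxc := hx (Metric.mem_closedBall_self hr₀.le)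
  have habs : |inner ℝ p (∑ k, w k • (z k : Space d)) + c| ≤ M := by
    rw [← hmaj.envelope_sum_eq hw hz]
    exact abs_envelope_le hM hxc
  have hM0 : 0 ≤ M := (abs_nonneg _).trans habs
  have hp := hmaj.norm_le hr₀ hM hx (abs_le.1 habs).2
  have hc := abs_const_le_of_abs_inner_add_le hxc hp habs
  have hpR : ‖p‖ ≤ R := by
    nlinarith [(show 0 ≤ 2 * M / r₀ * d by positivity)]
  have hcR : |c| ≤ R := by
    nlinarith [(show 0 ≤ 2 * M / r₀ by positivity)]
  choose T hT using fun k => hcontact (z k) (hmaj.mem_contactSet (hz k))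
  have hnorm (k : Fin d) : ‖(P (T k) : Space d) - z k‖ ≤ r := by
    rw [← dist_eq_norm, dist_comm]
    exact (hT k).le
  refine ⟨p, c, T, hpR, hcR, ⟨fun i => ?_, fun k => ?_⟩, w, hw, norm_sum_smul_sub_le hw hnorm⟩
  · linarith [(abs_le.1 (hfg (P i))).1, hmaj (P i), (abs_nonneg _).trans (hfg (P i))]
  · have hinner : inner ℝ p ((P (T k) : Space d) - z k) ≤ τ / 4 :=
      ((real_inner_le_norm _ _).trans
        (mul_le_mul hpR (hnorm k) (norm_nonneg _) ((norm_nonneg p).trans hpR))).trans hRr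
    rw [inner_sub_right] at hinner
    linarith [(abs_lt.1 (hg _ _ (hT k))).2, (abs_le.1 (hfg (z k))).2, hz k,
      (abs_nonneg _).trans (hfg (z k))]

theorem exists_second_difference_le {ι α : Type*} [Fintype ι] [Fintype α] {P : ι → cube d}
    {T : α → ι} {κ R τ η ρ : ℝ} (hgap : GapBelowNodes g P κ) (hκ : 0 ≤ κ)
    (hsep : HasSeparatedSupports g P T R τ) (hτ : 0 < τ) (hρ : 0 < ρ)
    (hfg : ∀ y, |f y - g y| ≤ η) (hη : 8 * η ≤ ρ * τ) (hp : ‖p‖ ≤ R) (hc : |c| ≤ R)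
    (hsupp : SupportsNodes g P T τ p c) {w : α → ℝ} (hw : w ∈ stdSimplex ℝ α) {z : Space d}
    (hz : ∑ k, w k • (P (T k) : Space d) = z) (hball : Metric.closedBall z ρ ⊆ cube d) :
    ∃ u : Space d, ‖u‖ = 1 ∧
      envelope 1 f (z + ρ • u) + envelope 1 f (z - ρ • u) - 2 * envelope 1 f z ≤ -(ρ * τ / 2) := by
  obtain ⟨p₁, c₁, p₂, c₂, hτp, h₁, h₂⟩ := hsep p c hp hc hsupp
  have hpos : 0 < ‖p₁ - p₂‖ := hτ.trans_le hτp
  set u := ‖p₁ - p₂‖⁻¹ • (p₁ - p₂)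
  have hu : ‖u‖ = 1 := norm_smul_inv_norm (norm_pos_iff.1 hpos)
  have hinner : ρ * τ ≤ inner ℝ (p₁ - p₂) (ρ • u) := by
    rw [real_inner_smul_right, real_inner_smul_right, real_inner_self_eq_norm_sq, sq,
      inv_mul_cancel_left₀ hpos.ne']
    gcongr
  have hρu : ‖ρ • u‖ = ρ := by rw [norm_smul, hu, mul_one, Real.norm_of_nonneg hρ.le]
  have hadd : z + ρ • u ∈ cube d := hball (by simp [hρu])
  have hsub : z - ρ • u ∈ cube d := hball (by simp [hρu])
  have hself : z ∈ cube d := hball (Metric.mem_closedBall_self hρ.le)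
  refine ⟨u, hu, ?_⟩
  linarith [h₁.second_difference_le hgap hκ h₂ hw hz hadd hsub,
    (abs_le.1 (abs_envelope_sub_le hfg hadd)).2, (abs_le.1 (abs_envelope_sub_le hfg hsub)).2,
    (abs_le.1 (abs_envelope_sub_le hfg hself)).1]

theorem sharpRidges_of_hasSeparatedSupports {ι : Type*} [Fintype ι] {P : ι → cube d} {n : ℕ}
    {M R κ τ η ρ r : ℝ} (hgap : GapBelowNodes g P κ) (hκ : 0 ≤ κ)
    (hsep : ∀ T : Fin d → ι, HasSeparatedSupports g P T R τ) (hτ : 0 < τ) (hρ : 0 < ρ)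
    (hρn : 2 * ρ < 1 / (n + 1)) (hρτ : 2 * (n + 1) * ρ ^ (1 / ((n : ℝ) + 1)) ≤ τ) (hr : r ≤ ρ)
    (hM : ∀ y, |f y| ≤ M) (hR : 2 * M / (1 / (n + 1)) * (d + 1) + M ≤ R) (hRr : R * r ≤ τ / 4)
    (hfg : ∀ y, |f y - g y| ≤ η) (hη : 8 * η ≤ ρ * τ)
    (hg : ∀ y z, dist y z < r → dist (g y) (g z) < τ / 4)
    (hcontact : ∀ z : cube d, (z : Space d) ∈ contactSet 1 f → ∃ i, dist z (P i) < r) :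
    SharpRidges n f := by
  have hn : (1 : ℝ) / (n + 1) ≤ 1 :=
    div_le_one_of_le₀ (by linarith [n.cast_nonneg (α := ℝ)]) (by positivity)
  refine ⟨ρ, hρ, hρn, fun x hx hridge => ?_⟩
  obtain ⟨p, c, T, hp, hc, hsupp, w, hw, hzx⟩ := hridge.exists_supportsNodes (by positivity) hx hM
    hR hRr (fun y => (hfg y).trans (by nlinarith)) hg hcontact
  set z := ∑ k, w k • (P (T k) : Space d) with hz
  have hball : Metric.closedBall z ρ ⊆ cube d := by
    refine (Metric.closedBall_subset_closedBall' ?_).trans hx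
    rw [dist_eq_norm]
    linarith
  obtain ⟨u, hu, hle⟩ := exists_second_difference_le hgap hκ (hsep T) hτ hρ hfg hη hp hc hsupp hw
    hz.symm hball
  refine ⟨z, u, hzx.trans hr, hu, hle.trans (neg_le_neg ?_)⟩
  rw [Real.rpow_add hρ, Real.rpow_one]
  nlinarith

theorem thinContact_and_sharpRidges_mem_residual (hd : 0 < d) (n : ℕ) :
    {f : C(cube d, ℝ) | ThinContact n f ∧ SharpRidges n f} ∈ residual C(cube d, ℝ) := by
  refine mem_residual_of_exists_ball fun f₀ ε hε => ?_
  obtain ⟨g, m, κ, hκ, hgf₀, hgap, hgen⟩ := exists_polyhedral_dist_lt f₀ hε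
  refine ⟨g, hgf₀, ?_⟩
  have hd' : Nonempty (Fin d) := Fin.pos_iff_nonempty.1 hd
  have hn : (0 : ℝ) < 1 / (n + 1) := by positivity
  have hn1 : (1 : ℝ) / (n + 1) ≤ 1 :=
    div_le_one_of_le₀ (by linarith [n.cast_nonneg (α := ℝ)]) (by positivity)
  set M : ℝ := ‖g‖ + 1
  set R : ℝ := 2 * M / (1 / (n + 1)) * (d + 1) + M
  have hR : 0 < R := by positivity
  obtain ⟨τ, hsep, hτ : 0 < τ⟩ := ((eventually_all.2 fun T =>
    hgen.eventually_hasSeparatedSupports (Fintype.card_fin d).le T R).and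
    eventually_mem_nhdsWithin).exists
  obtain ⟨δ, hδ, hmod⟩ := Metric.uniformContinuous_iff.1
    (CompactSpace.uniformContinuous_of_continuous g.continuous) (τ / 4) (by positivity)
  obtain ⟨ρ, ⟨hρ, hρn⟩, hρτ⟩ := (Eventually.and (Ioo_mem_nhdsGT (half_pos hn))
    (eventually_mul_rpow_lt hn (2 * (n + 1)) hτ)).exists
  obtain ⟨r, ⟨hr, hr'⟩, hcard⟩ := (Eventually.and (Ioo_mem_nhdsGT
    (lt_min (lt_min hn hρ) (lt_min hδ (show 0 < τ / 4 / R by positivity))))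
    (eventually_mul_rpow_lt hn (Fintype.card (Fin d → Fin (m + 1))) hn)).exists
  obtain ⟨⟨hrn, hrρ⟩, hrδ, hrR⟩ := by simpa only [lt_min_iff] using hr'
  obtain ⟨η, hη, hη'⟩ := exists_between (lt_min (lt_min one_pos (show 0 < κ * r / 2 by positivity))
    (show 0 < ρ * τ / 8 by positivity))
  obtain ⟨⟨hη1, hηκ⟩, hηρ⟩ := by simpa only [lt_min_iff] using hη'
  refine ⟨η, hη, fun f hf => ?_⟩
  have hfg := abs_sub_le_of_mem_ball hf
  have hfM (y : cube d) : |f y| ≤ M := by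
    have := abs_sub_abs_le_abs_sub (f y) (g y)
    linarith [hfg y, g.norm_coe_le_norm y, Real.norm_eq_abs (g y)]
  have hcontact (x : cube d) (hx : (x : Space d) ∈ contactSet 1 f) :
      ∃ i, dist x (gridPoint m i) < r :=
    hgap.exists_dist_lt hκ (hrn.le.trans hn1) (by linarith) hfg hx
  refine ⟨⟨_, inferInstance, gridPoint m, r, hr, hrn, fun x hx => hcontact ⟨x, hx.1⟩ hx,
    hcard.le⟩, sharpRidges_of_hasSeparatedSupports hgap hκ.le hsep hτ hρ (by linarith) hρτ.le hrρ.le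
    hfM le_rfl ?_ hfg (by linarith) (fun y z h => hmod (h.trans hrδ)) hcontact⟩
  rw [mul_comm]
  exact ((lt_div_iff₀ hR).1 hrR).le

end Ridges

/-! ### Hölder exponents -/

section HolderExponent

variable {d : ℕ} {φ : Space d → ℝ} {x : Space d}

theorem exists_nat_one_div_lt_and_lt {r : ℝ} (hr : 0 < r) (K : ℝ) :
    ∃ n : ℕ, 1 / ((n : ℝ) + 1) < r ∧ K < n + 1 := by
  obtain ⟨m, hm⟩ := exists_nat_gt K
  obtain ⟨n, hn⟩ := exists_nat_one_div_lt hr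
  refine ⟨max m n, (Nat.one_div_le_one_div (le_max_right m n)).trans_lt hn, ?_⟩
  have hmn : (m : ℝ) ≤ (max m n : ℕ) := by exact_mod_cast le_max_left m n
  linarith

theorem exists_eval_sub_affine_le (P : MvPolynomial (Fin d) ℝ) :
    ∃ (a : ℝ) (q : Space d) (C : ℝ), 0 ≤ C ∧ ∀ v : Space d, ‖v‖ ≤ 1 →
      |MvPolynomial.eval (fun j => v j) P - (a + inner ℝ q v)| ≤ C * ‖v‖ ^ 2 := by
  induction P using MvPolynomial.induction_on with
  | C a => exact ⟨a, 0, 0, le_rfl, fun v _ => by simp⟩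
  | add P Q hP hQ =>
    obtain ⟨a, q, C, hC, h⟩ := hP
    obtain ⟨a', q', C', hC', h'⟩ := hQ
    refine ⟨a + a', q + q', C + C', add_nonneg hC hC', fun v hv => ?_⟩
    rw [map_add, inner_add_left, add_add_add_comm, add_sub_add_comm, add_mul]
    exact (abs_add_le _ _).trans (add_le_add (h v hv) (h' v hv))
  | mul_X P i hP =>
    obtain ⟨a, q, C, hC, h⟩ := hP
    refine ⟨0, a • EuclideanSpace.single i (1 : ℝ), C + ‖q‖, by positivity, fun v hv => ?_⟩
    have hP : |MvPolynomial.eval (fun j => v j) P - a| ≤ (C + ‖q‖) * ‖v‖ := by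
      have hsq : C * ‖v‖ ^ 2 ≤ C * ‖v‖ := by
        gcongr
        exact pow_le_of_le_one (norm_nonneg v) hv two_ne_zero
      have := abs_sub_abs_le_abs_sub (MvPolynomial.eval (fun j => v j) P - a) (inner ℝ q v)
      rw [sub_sub] at this
      linarith [h v hv, abs_real_inner_le_norm q v]
    calc |MvPolynomial.eval (fun j => v j) (P * MvPolynomial.X i)
          - (0 + inner ℝ (a • EuclideanSpace.single i (1 : ℝ)) v)|
        = |MvPolynomial.eval (fun j => v j) P - a| * |v i| := by
          rw [← abs_mul]
          simp [real_inner_smul_left, EuclideanSpace.inner_single_left, sub_mul]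
      _ ≤ (C + ‖q‖) * ‖v‖ * ‖v‖ := by
          gcongr
          simpa using PiLp.norm_apply_le v i
      _ = (C + ‖q‖) * ‖v‖ ^ 2 := by ring

theorem exists_totalDegree_le_one_eval_eq (a : ℝ) (q : Space d) :
    ∃ P : MvPolynomial (Fin d) ℝ, P.totalDegree ≤ 1 ∧
      ∀ v : Space d, MvPolynomial.eval (fun j => v j) P = a + inner ℝ q v := by
  refine ⟨MvPolynomial.C a + ∑ j, MvPolynomial.C (q j) * MvPolynomial.X j, ?_, fun v => ?_⟩
  · refine (MvPolynomial.totalDegree_add _ _).trans (max_le (by simp) ?_)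
    refine MvPolynomial.totalDegree_finsetSum_le fun j _ => ?_
    exact (MvPolynomial.totalDegree_mul _ _).trans (by simp)
  · simp [PiLp.inner_apply, mul_comm]

theorem MemHolderAt.exists_sub_affine_le {h : ℝ≥0} (H : MemHolderAt φ h x) :
    ∃ (a : ℝ) (q : Space d) (C : ℝ), 0 ≤ C ∧ ∀ᶠ y in 𝓝[cube d] x,
      |φ y - (a + inner ℝ q (y - x))| ≤ C * ‖y - x‖ ^ min (h : ℝ) 2 := by
  obtain ⟨P, -, C, hφ⟩ := H
  obtain ⟨a, q, C', hC', hP⟩ := exists_eval_sub_affine_le P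
  refine ⟨a, q, |C| + C', by positivity, ?_⟩
  filter_upwards [hφ, nhdsWithin_le_nhds (Metric.closedBall_mem_nhds x one_pos)] with y hy hyx
  rw [mem_closedBall_iff_norm] at hyx
  have hle (e : ℝ) (he : min (h : ℝ) 2 ≤ e) : ‖y - x‖ ^ e ≤ ‖y - x‖ ^ min (h : ℝ) 2 :=
    Real.rpow_le_rpow_of_exponent_ge' (norm_nonneg _) hyx (by positivity) he
  have hPy := hP (y - x) hyx
  simp only [PiLp.sub_apply] at hPy
  calc |φ y - (a + inner ℝ q (y - x))|
      ≤ C * ‖y - x‖ ^ (h : ℝ) + C' * ‖y - x‖ ^ 2 :=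
        (abs_sub_le _ _ _).trans (add_le_add hy hPy)
    _ ≤ |C| * ‖y - x‖ ^ min (h : ℝ) 2 + C' * ‖y - x‖ ^ min (h : ℝ) 2 := by
        rw [← Real.rpow_two]
        exact add_le_add
          (mul_le_mul (le_abs_self C) (hle _ (min_le_left _ _)) (by positivity) (abs_nonneg C))
          (mul_le_mul_of_nonneg_left (hle _ (min_le_right _ _)) hC')
    _ = (|C| + C') * ‖y - x‖ ^ min (h : ℝ) 2 := by ring

theorem MemHolderAt.exists_sub_le {h : ℝ≥0} (H : MemHolderAt φ h x) (hx : x ∈ cube d)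
    (hh : 0 < h) : ∃ C : ℝ, ∀ᶠ y in 𝓝[cube d] x,
      |φ y - φ x| ≤ C * ‖y - x‖ ^ min (h : ℝ) 1 := by
  obtain ⟨a, q, C, hC, hφ⟩ := H.exists_sub_affine_le
  have hpos : 0 < min (h : ℝ) 2 := lt_min (by exact_mod_cast hh) two_pos
  have ha : φ x = a := by
    have := hφ.self_of_nhdsWithin hx
    rw [sub_self, inner_zero_right, norm_zero, Real.zero_rpow hpos.ne', mul_zero, add_zero,
      abs_nonpos_iff] at this
    exact sub_eq_zero.1 this
  refine ⟨C + ‖q‖, ?_⟩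
  filter_upwards [hφ, nhdsWithin_le_nhds (Metric.closedBall_mem_nhds x one_pos)] with y hy hyx
  rw [mem_closedBall_iff_norm] at hyx
  have hle (e : ℝ) (he : min (h : ℝ) 1 ≤ e) : ‖y - x‖ ^ e ≤ ‖y - x‖ ^ min (h : ℝ) 1 :=
    Real.rpow_le_rpow_of_exponent_ge' (norm_nonneg _) hyx (by positivity) he
  calc |φ y - φ x| ≤ |φ y - (a + inner ℝ q (y - x))| + |inner ℝ q (y - x)| := by
        rw [ha]
        simpa using abs_sub_le (φ y) (a + inner ℝ q (y - x)) a
    _ ≤ C * ‖y - x‖ ^ min (h : ℝ) 2 + ‖q‖ * ‖y - x‖ ^ (1 : ℝ) :=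
        add_le_add hy (by simpa using abs_real_inner_le_norm q (y - x))
    _ ≤ C * ‖y - x‖ ^ min (h : ℝ) 1 + ‖q‖ * ‖y - x‖ ^ min (h : ℝ) 1 := by
        exact add_le_add (mul_le_mul_of_nonneg_left (hle _ (min_le_min_left _ one_le_two)) hC)
          (mul_le_mul_of_nonneg_left (hle _ (min_le_right _ _)) (norm_nonneg q))
    _ = (C + ‖q‖) * ‖y - x‖ ^ min (h : ℝ) 1 := by ring

theorem MemHolderAt.exists_second_difference_le {h : ℝ≥0} (H : MemHolderAt φ h x)
    (hx : cube d ∈ 𝓝 x) : ∃ C : ℝ, 0 ≤ C ∧ ∀ᶠ ρ in 𝓝[>] (0 : ℝ), ∀ z v : Space d,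
      ‖z - x‖ ≤ ρ → ‖v‖ ≤ ρ → |φ (z + v) + φ (z - v) - 2 * φ z| ≤ C * ρ ^ min (h : ℝ) 2 := by
  obtain ⟨a, q, C, hC, hφ⟩ := H.exists_sub_affine_le
  rw [nhdsWithin_eq_nhds.2 hx] at hφ
  obtain ⟨r, hr, hball⟩ := Metric.eventually_nhds_iff.1 hφ
  refine ⟨4 * (C * 2 ^ min (h : ℝ) 2), by positivity, ?_⟩
  filter_upwards [Ioo_mem_nhdsGT (half_pos hr)] with ρ hρ z v hz hv
  have hest (y : Space d) (hy : ‖y - x‖ ≤ 2 * ρ) :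
      |φ y - (a + inner ℝ q (y - x))| ≤ C * (2 ^ min (h : ℝ) 2 * ρ ^ min (h : ℝ) 2) := by
    rw [← Real.mul_rpow two_pos.le hρ.1.le]
    refine (hball (by rw [dist_eq_norm]; linarith [hρ.2])).trans ?_
    gcongr
  have hadd := abs_le.1 (hest (z + v) (by
    rw [add_sub_right_comm]; linarith [norm_add_le (z - x) v]))
  have hsub := abs_le.1 (hest (z - v) (by
    rw [sub_right_comm]; linarith [norm_sub_le (z - x) v]))
  have hmid := abs_le.1 (hest z (by linarith [hρ.1]))
  simp only [inner_sub_right, inner_add_right] at hadd hsub hmid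
  rw [abs_le]
  constructor <;> linarith [hadd.1, hadd.2, hsub.1, hsub.2, hmid.1, hmid.2]

theorem holderExponent_le_coe {b : ℝ≥0} (H : ∀ h > b, ¬ MemHolderAt φ h x) :
    holderExponent φ x ≤ b := by
  refine sSup_le ?_
  rintro _ ⟨h, hh, rfl⟩
  exact ENNReal.coe_le_coe.2 (not_lt.1 fun hlt => H h hlt hh)

theorem holderExponent_eq_top_of_affine {p : Space d} {c : ℝ}
    (h : ∀ᶠ y in 𝓝 x, φ y = inner ℝ p y + c) : holderExponent φ x = ⊤ := by
  obtain ⟨P, hdeg, hP⟩ := exists_totalDegree_le_one_eval_eq (inner ℝ p x + c) p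
  have hmem (n : ℕ) : MemHolderAt φ ((n : ℝ≥0) + 1) x := by
    refine ⟨P, hdeg.trans (by rw [Nat.floor_add_one (by positivity)]; omega), 0,
      nhdsWithin_le_nhds ?_⟩
    filter_upwards [h] with y hy
    have hPy := hP (y - x)
    simp only [PiLp.sub_apply] at hPy
    rw [hPy, hy, inner_sub_right]
    ring_nf
    simp
  refine ENNReal.eq_top_of_forall_nnreal_le fun r => ?_
  obtain ⟨n, hn⟩ := exists_nat_ge r
  refine le_trans ?_ (le_sSup ⟨_, hmem n, rfl⟩)
  exact_mod_cast hn.trans (le_add_of_nonneg_right zero_le_one)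

theorem one_le_holderExponent (h : DifferentiableAt ℝ φ x) : 1 ≤ holderExponent φ x := by
  refine le_sSup ⟨1, ?_, by simp⟩
  obtain ⟨C, hC⟩ := h.isBigO_sub.bound
  refine ⟨MvPolynomial.C (φ x), by simp, C, nhdsWithin_le_nhds ?_⟩
  filter_upwards [hC] with y hy
  simpa using hy

end HolderExponent

section Boundary

variable {d : ℕ} {f : C(cube d, ℝ)} {a : ℝ} {j : Fin d} {x : Space d}

theorem eventually_mul_le_envelope_inward_sub (ha : a = 0 ∨ a = 1) (H : ∀ n, SteepAlong a j n f)
    (hx : x ∈ face a j) (K : ℝ) :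
    ∀ᶠ t in 𝓝[>] (0 : ℝ), K * t ≤ envelope 1 f (inward a j t x) - envelope 1 f x := by
  obtain ⟨n, -, hn⟩ := exists_nat_one_div_lt_and_lt one_pos K
  obtain ⟨δ, hδ0, hδ1, hδ⟩ := H n
  have hn1 : (1 : ℝ) / (n + 1) ≤ 1 :=
    div_le_one_of_le₀ (by linarith [n.cast_nonneg (α := ℝ)]) (by positivity)
  have hslope : K * δ ≤ envelope 1 f (inward a j δ x) - envelope 1 f x := by
    refine le_trans ?_ (hδ x hx).le
    gcongr
    simpa using Real.rpow_le_rpow_of_exponent_ge hδ0 (hδ1.le.trans hn1) hn1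
  filter_upwards [Ioo_mem_nhdsGT hδ0] with t ⟨ht0, htδ⟩
  have hs : inward a j t x = (1 - t / δ) • x + (t / δ) • inward a j δ x := by
    have hscale : t / δ * (δ * (1 - 2 * a)) = t * (1 - 2 * a) := by field_simp
    simp only [inward, smul_add, smul_smul]
    rw [← add_assoc, ← add_smul, hscale, sub_add_cancel, one_smul]
  have hconc := (concaveOn_envelope f).2 hx.1
    (inward_mem_cube ha ⟨hδ0.le, hδ1.le.trans hn1⟩ hx)
    (sub_nonneg.2 ((div_le_one hδ0).2 htδ.le)) (show 0 ≤ t / δ by positivity) (by ring)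
  rw [← hs, smul_eq_mul, smul_eq_mul] at hconc
  have hscale : t / δ * (K * δ) ≤ t / δ * (envelope 1 f (inward a j δ x) - envelope 1 f x) := by
    gcongr
  have hKt : t / δ * (K * δ) = K * t := by field_simp
  linarith

theorem hasRightPartial_envelope (H : ∀ n, SteepAlong 0 j n f) (hx : x ∈ face 0 j) :
    HasRightPartial (envelope 1 f) j x ⊤ := by
  rw [HasRightPartial, EReal.tendsto_coe_nhds_top_iff, tendsto_atTop]
  intro K
  filter_upwards [eventually_mul_le_envelope_inward_sub (Or.inl rfl) H hx K,
    eventually_mem_nhdsWithin] with t ht ht0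
  rw [le_div_iff₀ ht0]
  simpa [inward] using ht

theorem hasLeftPartial_envelope (H : ∀ n, SteepAlong 1 j n f) (hx : x ∈ face 1 j) :
    HasLeftPartial (envelope 1 f) j x ⊥ := by
  rw [HasLeftPartial, EReal.tendsto_coe_nhds_bot_iff, tendsto_atBot]
  intro K
  have hneg : Tendsto (fun t : ℝ => -t) (𝓝[<] 0) (𝓝[>] 0) := by
    simpa using tendsto_neg_nhdsLT (a := (0 : ℝ))
  filter_upwards [hneg.eventually (eventually_mul_le_envelope_inward_sub (Or.inr rfl) H hx (-K)),
    eventually_mem_nhdsWithin] with t ht ht0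
  have hinward : inward 1 j (-t) x = x + t • EuclideanSpace.single j (1 : ℝ) := by
    norm_num [inward, smul_smul]
  rw [hinward] at ht
  rw [div_le_iff_of_neg ht0]
  linarith

theorem Majorizes.mem_openCube {p : Space d} {c : ℝ} (h : Majorizes p c f)
    (H : ∀ a : ℝ, a = 0 ∨ a = 1 → ∀ j n, SteepAlong a j n f) {z : cube d}
    (hz : f z = inner ℝ p (z : Space d) + c) : (z : Space d) ∈ openCube d := by
  by_contra hzo
  obtain ⟨j, a, ha, hza⟩ := exists_mem_face_of_notMem_openCube z.2 hzo
  obtain ⟨t, ht, ht0, ht1⟩ := ((eventually_mul_le_envelope_inward_sub ha (H a ha j) hza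
    (‖p‖ + 1)).and (Ioo_mem_nhdsGT one_pos)).exists
  have hle := h.envelope_le (inward_mem_cube ha ⟨ht0.le, ht1.le⟩ hza)
  have hinner := real_inner_le_norm p (inward a j t z - z)
  rw [norm_inward_sub ha j ht0.le, inner_sub_right] at hinner
  linarith [le_envelope f z]

theorem holderExponent_envelope_eq_zero (ha : a = 0 ∨ a = 1) (H : ∀ n, SteepAlong a j n f)
    (hx : x ∈ face a j) : holderExponent (envelope 1 f) x = 0 := by
  refine nonpos_iff_eq_zero.1 (holderExponent_le_coe (b := 0) fun h hh hmem => ?_)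
  obtain ⟨C, hφ⟩ := hmem.exists_sub_le hx.1 hh
  obtain ⟨r, hr, hball⟩ := Metric.nhdsWithin_basis_ball.eventually_iff.1 hφ
  obtain ⟨n, hn, hCn⟩ := exists_nat_one_div_lt_and_lt
    (lt_min hr (lt_min (show (0 : ℝ) < h by exact_mod_cast hh) one_pos)) C
  obtain ⟨hnr, hnh⟩ := lt_min_iff.1 hn
  obtain ⟨δ, hδ0, hδn, hδ⟩ := H n
  have hδ1 : δ ≤ 1 := (hδn.trans (hnh.trans_le (min_le_right _ _))).le
  have hsmall := hball ⟨Metric.mem_ball.2 (by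
    rw [dist_eq_norm, norm_inward_sub ha j hδ0.le]; exact hδn.trans hnr),
    inward_mem_cube ha ⟨hδ0.le, hδ1⟩ hx⟩
  rw [norm_inward_sub ha j hδ0.le] at hsmall
  refine lt_irrefl (envelope 1 f (inward a j δ x) - envelope 1 f x) ?_
  calc _ ≤ C * δ ^ min (h : ℝ) 1 := (le_abs_self _).trans hsmall
    _ ≤ (n + 1) * δ ^ (1 / ((n : ℝ) + 1)) := by
        have := Real.rpow_le_rpow_of_exponent_ge hδ0 hδ1 hnh.le
        gcongr
    _ < envelope 1 f (inward a j δ x) - envelope 1 f x := hδ x hx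

end Boundary

section Ridges

variable {d : ℕ} {f : C(cube d, ℝ)} {x p : Space d} {c : ℝ}

theorem sum_smul_mem_interior_convexHull {ι E : Type*} [Fintype ι] [NormedAddCommGroup E]
    [NormedSpace ℝ E] [FiniteDimensional ℝ E] {z : ι → E} (hz : AffineIndependent ℝ z)
    (hcard : Module.finrank ℝ E < Fintype.card ι) {w : ι → ℝ} (hw : ∀ i, 0 < w i)
    (h1 : ∑ i, w i = 1) : ∑ i, w i • z i ∈ interior (convexHull ℝ (range z)) := by
  have hcard' : Fintype.card ι = Module.finrank ℝ E + 1 :=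
    (hz.card_le_finrank_succ.trans (Nat.succ_le_succ (Submodule.finrank_le _))).antisymm hcard
  let B : AffineBasis ι ℝ E := ⟨z, hz, hz.affineSpan_eq_top_iff_card_eq_finrank_add_one.2 hcard'⟩
  change ∑ i, w i • B i ∈ interior (convexHull ℝ (range B))
  rw [B.interior_convexHull, ← Finset.affineCombination_eq_linear_combination _ _ _ h1]
  intro i
  rw [B.coord_apply_combination_of_mem (Finset.mem_univ i) h1]
  exact hw i

theorem Majorizes.eventually_envelope_eq (h : Majorizes p c f) {ι : Type*} {z : ι → Space d}
    (hz : ∀ i, ∃ hi : z i ∈ cube d, f ⟨z i, hi⟩ = inner ℝ p (z i) + c)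
    (hx : x ∈ interior (convexHull ℝ (range z))) :
    ∀ᶠ y in 𝓝 x, envelope 1 f y = inner ℝ p y + c := by
  have hsub : convexHull ℝ (range z) ⊆ {y ∈ cube d | c ≤ (envelope 1 f - innerₛₗ ℝ p) y} := by
    refine convexHull_min ?_ (((concaveOn_envelope f).sub
      ((innerₛₗ ℝ p).convexOn (convex_cube d))).convex_ge c)
    rintro _ ⟨i, rfl⟩
    obtain ⟨hi, hfi⟩ := hz i
    exact ⟨hi, le_sub_iff_add_le'.2 (hfi.ge.trans (le_envelope f ⟨z i, hi⟩))⟩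
  filter_upwards [mem_interior_iff_mem_nhds.1 hx] with y hy
  exact (h.envelope_le (hsub hy).1).antisymm (le_sub_iff_add_le'.1 (hsub hy).2)

theorem eventually_envelope_eq_or_isRidgePoint (hx : x ∈ openCube d) :
    (∃ (p : Space d) (c : ℝ), ∀ᶠ y in 𝓝 x, envelope 1 f y = inner ℝ p y + c) ∨
      IsRidgePoint f x := by
  obtain ⟨p, c, hp, hval⟩ := exists_majorizes_envelope_eq f hx
  have hxh : x ∈ convexHull ℝ {y | ∃ h : y ∈ cube d, f ⟨y, h⟩ = inner ℝ p y + c} := by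
    obtain ⟨ι, _, w, z, hw, rfl, htouch⟩ := exists_touching_points f (openCube_subset_cube d hx)
    exact (convex_convexHull ℝ _).sum_mem (fun i _ => hw.1 i) hw.2 fun i _ =>
      subset_convexHull ℝ _ ⟨(z i).2, htouch p c hp hval i⟩
  obtain ⟨ι, _, z, w, hz, hai, hw, h1, rfl⟩ := eq_pos_convex_span_of_mem_convexHull hxh
  rcases le_or_gt (Fintype.card ι) d with hcard | hcard
  · right
    obtain ⟨z', w', hw', hrange, hsum⟩ := exists_fin_stdSimplex hcard z ⟨fun i => (hw i).le, h1⟩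
    choose hzc hzf using fun k => hz (hrange k)
    exact ⟨p, c, fun k => ⟨z' k, hzc k⟩, hp, hzf, w', hw', hsum⟩
  · left
    exact ⟨p, c, hp.eventually_envelope_eq (fun i => hz (mem_range_self i)) <|
      sum_smul_mem_interior_convexHull hai (by rwa [finrank_euclideanSpace_fin]) hw h1⟩
end Ridges

section Supergradients

variable {E : Type*} [NormedAddCommGroup E] [InnerProductSpace ℝ E] {s t : Set E} {φ : E → ℝ}
  {p : E → E} {x : E}

theorem eventually_norm_supergradient_le (hs : IsOpen s) (hst : s ⊆ t) (hφ : ContinuousOn φ s)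
    (hp : ∀ x ∈ s, ∀ y ∈ t, φ y ≤ φ x + inner ℝ (p x) (y - x)) (hx : x ∈ s) :
    ∃ R : ℝ, ∀ᶠ y in 𝓝 x, ‖p y‖ ≤ R := by
  have hφx := Metric.tendsto_nhds.1 (hφ.continuousAt (hs.mem_nhds hx)) 1 one_pos
  obtain ⟨r, hr, hball⟩ := Metric.eventually_nhds_iff_ball.1 (hφx.and (hs.mem_nhds hx))
  have hr2 : 0 < r / 2 := half_pos hr
  refine ⟨2 / (r / 2), ?_⟩
  filter_upwards [Metric.ball_mem_nhds x hr2] with y hy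
  rw [le_div_iff₀ hr2]
  rcases eq_or_ne (p y) 0 with hpy | hpy
  · simp [hpy]
  have hpos : 0 < ‖p y‖ := norm_pos_iff.2 hpy
  have hnorm : ‖(r / 2 / ‖p y‖) • p y‖ = r / 2 := by
    rw [norm_smul, norm_div, norm_norm, div_mul_cancel₀ _ hpos.ne', Real.norm_of_nonneg hr2.le]
  have hz : y - (r / 2 / ‖p y‖) • p y ∈ Metric.ball x r := by
    rw [mem_ball_iff_norm] at hy ⊢
    rw [sub_right_comm]
    linarith [norm_sub_le (y - x) ((r / 2 / ‖p y‖) • p y)]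
  obtain ⟨hφy, hys⟩ := hball y (Metric.ball_subset_ball (half_le_self hr.le) hy)
  have hsup := hp y hys _ (hst (hball _ hz).2)
  rw [sub_sub_cancel_left, inner_neg_right, real_inner_smul_right, real_inner_self_eq_norm_sq,
    pow_two, ← mul_assoc, div_mul_cancel₀ _ hpos.ne'] at hsup
  have hφz := (hball _ hz).1
  rw [Real.dist_eq, abs_lt] at hφy hφz
  linarith [hφy.2, hφz.1]

theorem continuousOn_of_unique_supergradient [FiniteDimensional ℝ E] (hs : IsOpen s)
    (hst : s ⊆ t) (hφ : ContinuousOn φ s)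
    (hp : ∀ x ∈ s, ∀ y ∈ t, φ y ≤ φ x + inner ℝ (p x) (y - x))
    (huniq : ∀ x ∈ s, ∀ q, (∀ y ∈ t, φ y ≤ φ x + inner ℝ q (y - x)) → q = p x) :
    ContinuousOn p s := by
  intro x hx
  obtain ⟨R, hR⟩ := eventually_norm_supergradient_le hs hst hφ hp hx
  refine Tendsto.mono_left ?_ nhdsWithin_le_nhds
  refine (isCompact_closedBall (0 : E) R).tendsto_nhds_of_unique_mapClusterPt
    (hR.mono fun y hy => mem_closedBall_zero_iff.2 hy) fun q _ hq => ?_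
  obtain ⟨U, hU, hUq⟩ := mapClusterPt_iff_ultrafilter.1 hq
  refine huniq x hx q fun y hy => ?_
  have hlim : Tendsto (fun w => φ w + inner ℝ (p w) (y - w)) U (𝓝 (φ x + inner ℝ q (y - x))) :=
    ((hφ.continuousAt (hs.mem_nhds hx)).tendsto.mono_left hU).add
      (hUq.inner (tendsto_const_nhds.sub hU))
  exact ge_of_tendsto hlim ((hs.eventually_mem hx).filter_mono hU |>.mono fun w hw => hp w hw y hy)

variable [CompleteSpace E]

theorem hasGradientAt_of_supergradient (hs : IsOpen s) (hst : s ⊆ t)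
    (hp : ∀ x ∈ s, ∀ y ∈ t, φ y ≤ φ x + inner ℝ (p x) (y - x)) (hx : x ∈ s)
    (hpx : ContinuousAt p x) : HasGradientAt φ (p x) x := by
  refine hasGradientAt_iff_isLittleO.2 (Asymptotics.isLittleO_iff.2 fun ε hε => ?_)
  filter_upwards [hs.mem_nhds hx, Metric.tendsto_nhds.1 hpx ε hε] with y hy hyε
  have hupper := hp x hx y (hst hy)
  have hlower := hp y hy x (hst hx)
  have hdiff : |inner ℝ (p y - p x) (y - x)| ≤ ε * ‖y - x‖ := by
    refine (abs_real_inner_le_norm _ _).trans ?_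
    gcongr
    exact (dist_eq_norm (p y) (p x)).symm.trans_le hyε.le
  rw [inner_sub_left, abs_le] at hdiff
  rw [← neg_sub y x, inner_neg_right] at hlower
  rw [Real.norm_eq_abs, abs_le]
  constructor <;> linarith [hdiff.1, hdiff.2, (abs_nonneg _).trans (abs_le.2 hdiff)]

theorem contDiffOn_one_of_unique_supergradient [FiniteDimensional ℝ E] (hs : IsOpen s)
    (hst : s ⊆ t) (hφ : ContinuousOn φ s)
    (hp : ∀ x ∈ s, ∃! q : E, ∀ y ∈ t, φ y ≤ φ x + inner ℝ q (y - x)) : ContDiffOn ℝ 1 φ s := by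
  choose! p hp huniq using hp
  have hcont := continuousOn_of_unique_supergradient hs hst hφ hp huniq
  have hgrad (x : E) (hx : x ∈ s) := hasGradientAt_of_supergradient hs hst hp hx
    (hcont.continuousAt (hs.mem_nhds hx))
  rw [← zero_add (1 : WithTop ℕ∞), contDiffOn_succ_iff_fderiv_of_isOpen hs, contDiffOn_zero]
  refine ⟨fun x hx => (hgrad x hx).differentiableAt.differentiableWithinAt, by simp, ?_⟩
  exact ((InnerProductSpace.toDual ℝ E).continuous.comp_continuousOn hcont).congr fun x hx =>
    (hgrad x hx).hasFDerivAt.fderiv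

end Supergradients

section Interior

variable {d : ℕ} {f : C(cube d, ℝ)} {x : Space d}

theorem holderExponent_envelope_le_one (hx : x ∈ openCube d) (hridge : IsRidgePoint f x)
    (H : ∀ n, SharpRidges n f) : holderExponent (envelope 1 f) x ≤ 1 := by
  refine holderExponent_le_coe (b := 1) fun h hh hmem => ?_
  obtain ⟨r', hr', hcube⟩ := exists_closedBall_subset_cube hx
  obtain ⟨C, hC, hφ⟩ := hmem.exists_second_difference_le
    (mem_of_superset (Metric.closedBall_mem_nhds x hr') hcube)
  obtain ⟨r, hr, hsmall⟩ := mem_nhdsGT_iff_exists_Ioo_subset.1 hφ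
  obtain ⟨n, hn, hCn⟩ := exists_nat_one_div_lt_and_lt (lt_min (lt_min hr hr') (lt_min one_pos
    (sub_pos.2 (show (1 : ℝ) < h by exact_mod_cast hh)))) C
  obtain ⟨⟨hnr, hnr'⟩, hn1, hnh⟩ := by simpa only [lt_min_iff] using hn
  obtain ⟨ρ, hρ0, hρn, hρ⟩ := H n
  obtain ⟨z, u, hz, hu, hsec⟩ := hρ x
    ((Metric.closedBall_subset_closedBall hnr'.le).trans hcube) hridge
  have hρu : ‖ρ • u‖ = ρ := by rw [norm_smul, hu, mul_one, Real.norm_of_nonneg hρ0.le]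
  have hexp : 1 + 1 / ((n : ℝ) + 1) ≤ min (h : ℝ) 2 := le_min (by linarith) (by linarith)
  have hlower := neg_le_of_abs_le (hsmall ⟨hρ0, by linarith⟩ z (ρ • u) hz hρu.le)
  have hpow : C * ρ ^ min (h : ℝ) 2 < (n + 1) * ρ ^ (1 + 1 / ((n : ℝ) + 1)) :=
    (mul_le_mul_of_nonneg_left (Real.rpow_le_rpow_of_exponent_ge hρ0 (by linarith) hexp)
      hC).trans_lt (mul_lt_mul_of_pos_right hCn (by positivity))
  linarith

theorem Majorizes.eq_of_envelope_eq (hsteep : ∀ a : ℝ, a = 0 ∨ a = 1 → ∀ j n, SteepAlong a j n f)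
    (hwedge : ∀ n, WedgeFree n f) (hx : x ∈ cube d) {p₁ p₂ : Space d} {c₁ c₂ : ℝ}
    (h₁ : Majorizes p₁ c₁ f) (hx₁ : envelope 1 f x = inner ℝ p₁ x + c₁)
    (h₂ : Majorizes p₂ c₂ f) (hx₂ : envelope 1 f x = inner ℝ p₂ x + c₂) : p₁ = p₂ := by
  by_contra hne
  have hpos : 0 < ‖p₁ - p₂‖ := norm_pos_iff.2 (sub_ne_zero.2 hne)
  obtain ⟨ι, _, w, z, hw, -, htouch⟩ := exists_touching_points f hx
  obtain ⟨i, -⟩ := Finset.nonempty_of_sum_ne_zero (hw.2.trans_ne one_ne_zero)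
  have hz₁ := htouch p₁ c₁ h₁ hx₁ i
  have hz₂ := htouch p₂ c₂ h₂ hx₂ i
  have hzf := le_envelope f (z i)
  obtain ⟨r, hr, hball⟩ := exists_closedBall_subset_cube (h₁.mem_openCube hsteep hz₁)
  obtain ⟨n, hn⟩ := exists_nat_one_div_lt (lt_min hr hpos)
  obtain ⟨hnr, hnp⟩ := lt_min_iff.1 hn
  obtain ⟨ρ, hρ0, hρn, hρ⟩ := hwedge n
  set v : Space d := (ρ / ‖p₁ - p₂‖) • (p₁ - p₂) with hv_def
  have hv : ‖v‖ = ρ := by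
    rw [norm_smul, norm_div, norm_norm, div_mul_cancel₀ _ hpos.ne', Real.norm_of_nonneg hρ0.le]
  have hadd : (z i : Space d) + v ∈ cube d := hball (by
    rw [mem_closedBall_iff_norm, add_sub_cancel_left, hv]; linarith)
  have hsub : (z i : Space d) - v ∈ cube d := hball (by
    rw [mem_closedBall_iff_norm, sub_sub_cancel_left, norm_neg, hv]; linarith)
  have hupper := h₁.second_difference_le h₂ (hz₁.symm.le.trans hzf) (hz₂.symm.le.trans hzf)
    hadd hsub
  rw [hv_def, real_inner_smul_right, real_inner_self_eq_norm_sq, ← hv_def, pow_two, ← mul_assoc,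
    div_mul_cancel₀ _ hpos.ne'] at hupper
  have hlower := hρ ⟨_, hadd⟩ ⟨_, hsub⟩ (z i) (by dsimp only; module) (by
    rw [show (z i : Space d) + v - (z i - v) = (2 : ℝ) • v by module, norm_smul, hv]; simp)
  have hgap : ρ / (n + 1) < ρ * ‖p₁ - p₂‖ := by
    rw [← mul_one_div]
    gcongr
  linarith [le_envelope f ⟨_, hadd⟩, le_envelope f ⟨_, hsub⟩,
    (h₁.mem_contactSet hz₁).2]

theorem contDiffOn_envelope (hsteep : ∀ a : ℝ, a = 0 ∨ a = 1 → ∀ j n, SteepAlong a j n f)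
    (hwedge : ∀ n, WedgeFree n f) : ContDiffOn ℝ 1 (envelope 1 f) (openCube d) := by
  refine contDiffOn_one_of_unique_supergradient (isOpen_openCube d) (openCube_subset_cube d)
    (((concaveOn_envelope f).subset (openCube_subset_cube d) (convex_openCube d)).continuousOn
      (isOpen_openCube d)) fun x hx => ?_
  obtain ⟨p, hp⟩ := exists_supergradient (concaveOn_envelope f) (openCube_subset_interior_cube d hx)
  exact ⟨p, hp, fun q hq => Majorizes.eq_of_envelope_eq hsteep hwedge (openCube_subset_cube d hx)
    (majorizes_of_supergradient hq) (by ring) (majorizes_of_supergradient hp) (by ring)⟩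

end Interior

/-! ### Hausdorff dimension estimates -/

theorem ediam_closedBall_le {X : Type*} [PseudoMetricSpace X] (x : X) {r : ℝ} (hr : 0 ≤ r) :
    Metric.ediam (Metric.closedBall x r) ≤ ENNReal.ofReal (2 * r) := by
  rw [← Metric.closedEBall_ofReal hr, ENNReal.ofReal_mul two_pos.le, ENNReal.ofReal_ofNat]
  exact Metric.ediam_closedEBall_le

theorem dimH_le_of_covers {X : Type*} [MetricSpace X] {S : Set X} {t : ℝ≥0} {A K : ℝ}
    (h : ∀ n : ℕ, ∃ (ι : Type) (_ : Fintype ι) (c : ι → X) (r : ℝ), 0 ≤ r ∧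
      r ≤ A * (1 / ((n : ℝ) + 1)) ∧ (∀ x ∈ S, ∃ i, dist x (c i) ≤ r) ∧
      Fintype.card ι * r ^ (t : ℝ) ≤ K) : dimH S ≤ t := by
  borelize X
  choose ι hι c r hr0 hr hcov hK using h
  have hr_lim : Tendsto (fun n => ENNReal.ofReal (2 * r n)) atTop (𝓝 0) := by
    have hA := tendsto_one_div_add_atTop_nhds_zero_nat.const_mul A
    rw [mul_zero] at hA
    simpa using ENNReal.tendsto_ofReal ((squeeze_zero hr0 hr hA).const_mul 2)
  have hsum : ∀ n, ∑ i, Metric.ediam (Metric.closedBall (c n i) (r n)) ^ (t : ℝ) ≤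
      ENNReal.ofReal (2 ^ (t : ℝ) * K) := fun n =>
    calc ∑ i, Metric.ediam (Metric.closedBall (c n i) (r n)) ^ (t : ℝ)
        ≤ ∑ _i : ι n, ENNReal.ofReal (2 * r n) ^ (t : ℝ) :=
          Finset.sum_le_sum fun i _ => ENNReal.rpow_le_rpow (ediam_closedBall_le _ (hr0 n)) t.2
      _ = ENNReal.ofReal (Fintype.card (ι n) * (2 * r n) ^ (t : ℝ)) := by
          rw [Finset.sum_const, nsmul_eq_mul, Finset.card_univ,
            ENNReal.ofReal_rpow_of_nonneg (mul_nonneg two_pos.le (hr0 n)) t.coe_nonneg,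
            ENNReal.ofReal_mul (Nat.cast_nonneg _), ENNReal.ofReal_natCast]
      _ ≤ _ := ENNReal.ofReal_le_ofReal <| by
          rw [Real.mul_rpow two_pos.le (hr0 n), mul_left_comm]
          exact mul_le_mul_of_nonneg_left (hK n) (by positivity)
  have hmeasure : MeasureTheory.Measure.hausdorffMeasure t S ≤ ENNReal.ofReal (2 ^ (t : ℝ) * K) :=
    calc _ ≤ _ := MeasureTheory.Measure.hausdorffMeasure_le_liminf_sum (t : ℝ) S _ hr_lim _
          (.of_forall fun n i => ediam_closedBall_le (c n i) (hr0 n))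
          (.of_forall fun n x hx => mem_iUnion.2 (hcov n x hx))
      _ ≤ liminf (fun _ : ℕ => ENNReal.ofReal (2 ^ (t : ℝ) * K)) atTop :=
          liminf_le_liminf (.of_forall hsum)
      _ = _ := liminf_const _
  exact dimH_le_of_hausdorffMeasure_ne_top (ne_top_of_le_ne_top ENNReal.ofReal_ne_top hmeasure)

section Contact

variable {d : ℕ} {f : C(cube d, ℝ)}

theorem exists_thin_cover_contactSet (H : ∀ n, ThinContact n f) {ε : ℝ} (hε : 0 < ε) (n : ℕ) :
    ∃ (ι : Type) (_ : Fintype ι) (P : ι → cube d) (r : ℝ), 0 < r ∧ r ≤ 1 / ((n : ℝ) + 1) ∧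
      (∀ x ∈ contactSet 1 f, ∃ i, dist x (P i) < r) ∧ Fintype.card ι * r ^ ε ≤ 1 := by
  obtain ⟨n₀, hn₀⟩ := exists_nat_one_div_lt hε
  obtain ⟨ι, hι, P, r, hr, hr1, hcov, hcard⟩ := H (max n n₀)
  have hN : (1 : ℝ) / ((max n n₀ : ℕ) + 1) ≤ 1 := by
    simpa using Nat.one_div_le_one_div (α := ℝ) (Nat.zero_le (max n n₀))
  refine ⟨ι, hι, P, r, hr, hr1.le.trans (Nat.one_div_le_one_div (le_max_left n n₀)), hcov, ?_⟩
  refine (mul_le_mul_of_nonneg_left ?_ (Nat.cast_nonneg _)).trans (hcard.trans hN)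
  exact Real.rpow_le_rpow_of_exponent_ge hr (hr1.le.trans hN)
    ((Nat.one_div_le_one_div (le_max_right n n₀)).trans hn₀.le)

theorem dimH_contactSet (H : ∀ n, ThinContact n f) : dimH (contactSet 1 f) = 0 := by
  refine nonpos_iff_eq_zero.1 (ENNReal.le_of_forall_pos_le_add fun ε hε _ => ?_)
  rw [zero_add]
  refine dimH_le_of_covers (A := 1) (K := 1) fun n => ?_
  obtain ⟨ι, hι, P, r, hr, hrn, hcov, hcard⟩ :=
    exists_thin_cover_contactSet H (NNReal.coe_pos.2 hε) n
  exact ⟨ι, hι, fun i => P i, r, hr.le, by rwa [one_mul],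
    fun x hx => (hcov x hx).imp fun i hi => hi.le, hcard⟩

end Contact

section Ridge

theorem sum_smul_eq_last_add {m : ℕ} {V : Type*} [AddCommGroup V] [Module ℝ V]
    {w : Fin (m + 1) → ℝ} (h1 : ∑ k, w k = 1) (y : Fin (m + 1) → V) :
    ∑ k, w k • y k = y (Fin.last m) +
      ∑ k : Fin m, w k.castSucc • (y k.castSucc - y (Fin.last m)) := by
  rw [Fin.sum_univ_castSucc] at h1
  rw [Fin.sum_univ_castSucc, eq_sub_of_add_eq' h1]
  simp only [smul_sub, Finset.sum_sub_distrib, sub_smul, one_smul, Finset.sum_smul]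
  abel

theorem exists_simplex_net {m : ℕ} {V ι : Type*} [SeminormedAddCommGroup V] [NormedSpace ℝ V]
    {P : ι → V} {D r : ℝ} (hP : ∀ i j, ‖P i - P j‖ ≤ D) (hr : 0 < r) :
    ∃ c : (Fin (m + 1) → ι) × (Fin m → Fin (⌊1 / r⌋₊ + 1)) → V,
      ∀ (T : Fin (m + 1) → ι), ∀ w ∈ stdSimplex ℝ (Fin (m + 1)),
        ∃ a, ‖∑ k, w k • P (T k) - c (T, a)‖ ≤ m * (r * D) := by
  refine ⟨fun b => P (b.1 (Fin.last m)) + ∑ k : Fin m, ((b.2 k : ℕ) * r) •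
    (P (b.1 k.castSucc) - P (b.1 (Fin.last m))), fun T w hw => ?_⟩
  refine ⟨fun k => ⟨⌊w k.castSucc / r⌋₊, Nat.lt_succ_of_le (Nat.floor_le_floor
    (div_le_div_of_nonneg_right (mem_Icc_of_mem_stdSimplex hw _).2 hr.le))⟩, ?_⟩
  have hround : ∀ k, ‖w k - (⌊w k / r⌋₊ : ℝ) * r‖ ≤ r := fun k => by
    have hle := Nat.floor_le (div_nonneg (hw.1 k) hr.le)
    have hlt := Nat.lt_floor_add_one (w k / r)
    rw [le_div_iff₀ hr] at hle
    rw [div_lt_iff₀ hr] at hlt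
    rw [Real.norm_eq_abs, abs_le]
    constructor <;> linarith
  rw [sum_smul_eq_last_add hw.2, add_sub_add_left_eq_sub, ← Finset.sum_sub_distrib]
  calc _ ≤ ∑ _k : Fin m, r * D := norm_sum_le_of_le _ fun k _ => by
        rw [← sub_smul, norm_smul]
        exact mul_le_mul (hround _) (hP _ _) (norm_nonneg _) hr.le
    _ = _ := by simp

theorem pow_mul_floor_pow_mul_rpow_le {m : ℕ} {N A r s : ℝ} (hN : 0 ≤ N) (hA : 0 ≤ A)
    (hr : 0 < r) (hr1 : r ≤ 1) (h : N * r ^ (s / (m + 1)) ≤ 1) :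
    N ^ (m + 1) * ((⌊1 / r⌋₊ : ℝ) + 1) ^ m * (A * r) ^ (m + s) ≤ 2 ^ m * A ^ (m + s) := by
  have hfloor : ((⌊1 / r⌋₊ : ℝ) + 1) * r ≤ 2 := by
    have := Nat.floor_le (one_div_pos.2 hr).le
    rw [le_div_iff₀ hr] at this
    linarith
  have hpow : N ^ (m + 1) * r ^ s ≤ 1 := by
    have hrs : r ^ s = (r ^ (s / (m + 1))) ^ (m + 1) := by
      rw [← Real.rpow_mul_natCast hr.le]
      congr 1
      push_cast
      field_simp
    rw [hrs, ← mul_pow]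
    exact pow_le_one₀ (by positivity) h
  calc N ^ (m + 1) * ((⌊1 / r⌋₊ : ℝ) + 1) ^ m * (A * r) ^ (m + s)
      = (((⌊1 / r⌋₊ : ℝ) + 1) * r) ^ m * A ^ (m + s) * (N ^ (m + 1) * r ^ s) := by
        rw [Real.mul_rpow hA hr.le, Real.rpow_add hr, Real.rpow_natCast, mul_pow]
        ring
    _ ≤ 2 ^ m * A ^ (m + s) * 1 := by gcongr
    _ = _ := mul_one _

theorem dimH_setOf_isRidgePoint_le {m : ℕ} {f : C(cube (m + 1), ℝ)} (H : ∀ n, ThinContact n f) :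
    dimH {x | IsRidgePoint f x} ≤ m := by
  refine ENNReal.le_of_forall_pos_le_add fun s hs _ => ?_
  set A : ℝ := 1 + m * (2 * (m + 1))
  rw [← ENNReal.coe_natCast, ← ENNReal.coe_add]
  refine dimH_le_of_covers (A := A) (K := 2 ^ m * A ^ ((m : ℝ) + s)) fun n => ?_
  obtain ⟨ι, _, P, r, hr, hrn, hcov, hcard⟩ := exists_thin_cover_contactSet H
    (div_pos (NNReal.coe_pos.2 hs) m.cast_add_one_pos) n
  have hr1 : r ≤ 1 := hrn.trans (by simpa using Nat.one_div_le_one_div (α := ℝ) n.zero_le)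
  have hdiam : ∀ i j, ‖(P i : Space (m + 1)) - P j‖ ≤ 2 * (m + 1) := fun i j => by
    have hi := norm_le_of_mem_cube (P i).2
    have hj := norm_le_of_mem_cube (P j).2
    push_cast at hi hj
    linarith [norm_sub_le (P i : Space (m + 1)) (P j)]
  obtain ⟨c, hc⟩ := exists_simplex_net (m := m) hdiam hr
  refine ⟨_, inferInstance, c, A * r, by positivity,
    mul_le_mul_of_nonneg_left hrn (by positivity), ?_, ?_⟩
  · rintro x ⟨p, b, z, hmaj, hz, w, hw, rfl⟩
    choose T hT using fun k => hcov _ (hmaj.mem_contactSet (hz k))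
    obtain ⟨a, ha⟩ := hc T w hw
    refine ⟨(T, a), ?_⟩
    calc dist _ (c (T, a)) ≤ r + m * (r * (2 * (m + 1))) := by
          rw [dist_eq_norm]
          refine (norm_sub_le_norm_sub_add_norm_sub _ _ _).trans (add_le_add
            (norm_sum_smul_sub_le hw fun k => ?_) ha)
          rw [← dist_eq_norm]
          exact (hT k).le
      _ = A * r := by ring
  · simpa using pow_mul_floor_pow_mul_rpow_le (A := A) (Nat.cast_nonneg _) (by positivity) hr hr1
      hcard

end Ridge

section Projection

variable {m : ℕ}

theorem dimH_face_le (a : ℝ) (j : Fin (m + 1)) : dimH (face a j) ≤ m := by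
  let F : Space m → Space (m + 1) := fun v =>
    WithLp.toLp 2 (j.insertNth (α := fun _ => ℝ) a fun k => v k)
  have hF : LipschitzWith 1 F := LipschitzWith.of_dist_le_mul fun u v => by
    rw [NNReal.coe_one, one_mul, EuclideanSpace.dist_eq, EuclideanSpace.dist_eq,
      Fin.sum_univ_succAbove _ j]
    simp [F]
  have hrange : face a j ⊆ range F := fun x hx => by
    refine ⟨WithLp.toLp 2 fun k => x (j.succAbove k), ?_⟩
    ext k
    refine Fin.succAboveCases j ?_ (fun i => ?_) k
    · simp [F, hx.2]
    · simp [F]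
  calc dimH (face a j) ≤ dimH (range F) := dimH_mono hrange
    _ ≤ dimH (univ : Set (Space m)) := hF.dimH_range_le
    _ = m := by rw [Real.dimH_univ_eq_finrank, finrank_euclideanSpace_fin]

theorem dimH_cube_diff_openCube_le (m : ℕ) :
    dimH (cube (m + 1) \ openCube (m + 1)) ≤ m := by
  have hfaces : cube (m + 1) \ openCube (m + 1) ⊆ ⋃ j, (face 0 j ∪ face 1 j) := by
    rintro x ⟨hx, hxo⟩
    obtain ⟨j, a, rfl | rfl, hxa⟩ := exists_mem_face_of_notMem_openCube hx hxo
    · exact mem_iUnion.2 ⟨j, Or.inl hxa⟩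
    · exact mem_iUnion.2 ⟨j, Or.inr hxa⟩
  refine (dimH_mono hfaces).trans ?_
  simp only [dimH_iUnion, dimH_union]
  exact iSup_le fun j => max_le (dimH_face_le 0 j) (dimH_face_le 1 j)

theorem openCube_nonempty (d : ℕ) : (openCube d).Nonempty :=
  ⟨WithLp.toLp 2 fun _ => 1 / 2, fun j => by constructor <;> norm_num⟩

theorem dimH_openCube (d : ℕ) : dimH (openCube d) = d := by
  rw [Real.dimH_of_nonempty_interior ((isOpen_openCube d).interior_eq.symm ▸ openCube_nonempty d),
    finrank_euclideanSpace_fin]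

theorem hausdorffDim_eq_natCast {d k : ℕ} {s : Set (Space d)} (hne : s.Nonempty)
    (h : dimH s = k) : hausdorffDim s = ((k : ℝ) : EReal) := by
  rw [hausdorffDim, if_neg hne.ne_empty, h]
  rfl

/-- The projection forgetting the first coordinate, used to bound Hausdorff dimensions from
below. -/
def dropFirst (x : Space (m + 1)) : Space m := WithLp.toLp 2 fun k => x k.succ

theorem lipschitzWith_dropFirst : LipschitzWith 1 (dropFirst (m := m)) :=
  LipschitzWith.of_dist_le_mul fun u v => by
    rw [NNReal.coe_one, one_mul, EuclideanSpace.dist_eq, EuclideanSpace.dist_eq,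
      Fin.sum_univ_succ]
    exact Real.sqrt_le_sqrt (le_add_of_nonneg_left (sq_nonneg _))

theorem hausdorffDim_eq_of_openCube_subset_dropFirst {S : Set (Space (m + 1))}
    (h : openCube m ⊆ dropFirst '' S) (hS : dimH S ≤ m) : hausdorffDim S = ((m : ℝ) : EReal) := by
  refine hausdorffDim_eq_natCast ((openCube_nonempty m).mono h).of_image (hS.antisymm ?_)
  calc (m : ℝ≥0∞) = dimH (openCube m) := (dimH_openCube m).symm
    _ ≤ dimH (dropFirst '' S) := dimH_mono h
    _ ≤ dimH S := lipschitzWith_dropFirst.dimH_image_le S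

theorem exists_mem_face_dropFirst_eq {v : Space m} (hv : v ∈ openCube m) :
    ∃ x ∈ face 0 (0 : Fin (m + 1)), dropFirst x = v := by
  refine ⟨WithLp.toLp 2 (Fin.cons 0 fun k => v k), ⟨fun k => ?_, by simp⟩, ?_⟩
  · cases k using Fin.cases with
    | zero => simp
    | succ k => simpa using Ioo_subset_Icc_self (hv k)
  · ext k
    simp [dropFirst]

theorem dropFirst_inward (a t : ℝ) (x : Space (m + 1)) :
    dropFirst (inward a 0 t x) = dropFirst x := by
  ext k
  simp [dropFirst, inward]

theorem inward_mem_openCube {t : ℝ} {x : Space (m + 1)} (ht : t ∈ Ioo (0 : ℝ) 1)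
    (hx : x ∈ face 0 0) (hv : dropFirst x ∈ openCube m) : inward 0 0 t x ∈ openCube (m + 1) := by
  refine Fin.cases ?_ fun k => ?_
  · rw [inward_apply_self, hx.2]
    simpa using ht
  · simpa [inward, dropFirst] using hv k

end Projection

section Line

theorem exists_affine_of_locally_affine {ψ : ℝ → ℝ} {s : Set ℝ} (hs : IsOpen s)
    (hs' : IsPreconnected s) (h : ∀ t ∈ s, ∃ α β : ℝ, ∀ᶠ u in 𝓝 t, ψ u = α + β * u) :
    ∃ α β : ℝ, ∀ t ∈ s, ψ t = α + β * t := by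
  have haffine : ∀ α β t : ℝ, HasDerivAt (fun u => α + β * u) β t := fun α β t => by
    simpa using ((hasDerivAt_id t).const_mul β).const_add α
  have hderiv : ∀ t ∈ s, DifferentiableAt ℝ ψ t ∧ HasDerivAt (deriv ψ) 0 t := fun t ht => by
    obtain ⟨α, β, hψ⟩ := h t ht
    refine ⟨((haffine α β t).congr_of_eventuallyEq hψ).differentiableAt, ?_⟩
    refine (hasDerivAt_const t β).congr_of_eventuallyEq (hψ.eventually_nhds.mono fun u hu => ?_)
    exact ((haffine α β u).congr_of_eventuallyEq hu).deriv
  obtain ⟨β, hβ⟩ := hs.exists_is_const_of_deriv_eq_zero hs'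
    (fun t ht => (hderiv t ht).2.differentiableAt.differentiableWithinAt)
    (fun t ht => (hderiv t ht).2.deriv)
  obtain ⟨α, hα⟩ := hs.exists_eq_add_of_deriv_eq (f := ψ) (g := fun u => 0 + β * u) hs'
    (fun t ht => (hderiv t ht).1.differentiableWithinAt)
    (fun t _ => (haffine 0 β t).differentiableAt.differentiableWithinAt)
    (fun t ht => (hβ t ht).trans (haffine 0 β t).deriv.symm)
  exact ⟨α, β, fun t ht => by simpa [add_comm] using hα ht⟩

variable {d : ℕ} {f : C(cube d, ℝ)} {x : Space d} {j : Fin d}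

theorem continuous_inward (a : ℝ) (j : Fin d) (x : Space d) :
    Continuous fun t => inward a j t x := by
  unfold inward
  fun_prop

theorem le_envelope_of_affine_on_line {α β : ℝ} (hx : x ∈ face 0 j)
    (h : ∀ t ∈ Ioo (0 : ℝ) 1, envelope 1 f (inward 0 j t x) = α + β * t) :
    α ≤ envelope 1 f x := by
  refine le_envelope_of_mem_graphHull ((isCompact_graphHull f).isClosed.mem_of_tendsto
    (b := 𝓝[>] (0 : ℝ)) (f := fun t : ℝ => (inward 0 j t x, α + β * t)) ?_ ?_)
  · have hcont : Continuous fun t : ℝ => (inward 0 j t x, α + β * t) :=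
      (continuous_inward 0 j x).prodMk (by fun_prop)
    simpa [inward] using (hcont.tendsto 0).mono_left (nhdsWithin_le_nhds (s := Ioi 0))
  · filter_upwards [Ioo_mem_nhdsGT one_pos] with t ht
    rw [← h t ht]
    exact mk_envelope_mem_graphHull f (inward_mem_cube (Or.inl rfl) ⟨ht.1.le, ht.2.le⟩ hx)

theorem exists_not_locally_affine_on_line (H : ∀ n, SteepAlong 0 j n f) (hx : x ∈ face 0 j) :
    ∃ t ∈ Ioo (0 : ℝ) 1, ¬ ∃ (p : Space d) (c : ℝ),
      ∀ᶠ y in 𝓝 (inward 0 j t x), envelope 1 f y = inner ℝ p y + c := by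
  by_contra! hall
  obtain ⟨α, β, hαβ⟩ := exists_affine_of_locally_affine isOpen_Ioo isPreconnected_Ioo
    (ψ := fun t => envelope 1 f (inward 0 j t x)) fun t ht => by
      obtain ⟨p, c, hpc⟩ := hall t ht
      refine ⟨inner ℝ p x + c, inner ℝ p (EuclideanSpace.single j (1 : ℝ)), ?_⟩
      filter_upwards [(continuous_inward 0 j x).continuousAt.eventually hpc] with u hu
      rw [hu, inward, mul_zero, sub_zero, one_smul, inner_add_right, real_inner_smul_right]
      ring
  have hα := le_envelope_of_affine_on_line hx hαβ
  obtain ⟨t, ht, hK⟩ := ((show ∀ᶠ t in 𝓝[>] (0 : ℝ), t ∈ Ioo (0 : ℝ) 1 from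
    Ioo_mem_nhdsGT one_pos).and
    (eventually_mul_le_envelope_inward_sub (Or.inl rfl) H hx (β + 1))).exists
  linarith [ht.1, hαβ t ht]

end Line

/-! ### Typical functions -/

/-- The properties of typical functions from which the structure of the upper envelope is
derived. -/
structure Typical {d : ℕ} (f : C(cube d, ℝ)) : Prop where
  steep : ∀ a : ℝ, a = 0 ∨ a = 1 → ∀ j n, SteepAlong a j n f
  wedgeFree : ∀ n, WedgeFree n f
  thinContact : ∀ n, ThinContact n f
  sharpRidges : ∀ n, SharpRidges n f

theorem typical_mem_residual {d : ℕ} (hd : 0 < d) :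
    {f : C(cube d, ℝ) | Typical f} ∈ residual C(cube d, ℝ) := by
  have hsteep : ∀ a : ℝ, a = 0 ∨ a = 1 → ∀ᶠ f in residual C(cube d, ℝ), ∀ j n, SteepAlong a j n f :=
    fun a ha => eventually_countable_forall.2 fun j => eventually_countable_forall.2
      fun n => steepAlong_mem_residual ha j n
  filter_upwards [hsteep 0 (Or.inl rfl), hsteep 1 (Or.inr rfl),
    eventually_countable_forall.2 (wedgeFree_mem_residual (K := cube d)),
    eventually_countable_forall.2 (thinContact_and_sharpRidges_mem_residual hd)]
    with f hsteep₀ hsteep₁ hwedge hridge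
  exact ⟨by rintro a (rfl | rfl); exacts [hsteep₀, hsteep₁], hwedge,
    fun n => (hridge n).1, fun n => (hridge n).2⟩

theorem typical_neg_mem_residual {d : ℕ} (hd : 0 < d) :
    {f : C(cube d, ℝ) | Typical (-f)} ∈ residual C(cube d, ℝ) :=
  tendsto_residual_of_isOpenMap (Homeomorph.neg C(cube d, ℝ)).continuous
    (Homeomorph.neg C(cube d, ℝ)).isOpenMap (typical_mem_residual hd)

theorem contactSet_one_nonempty {d : ℕ} (f : C(cube d, ℝ)) : (contactSet 1 f).Nonempty := by
  obtain ⟨z, -, hz⟩ := isCompact_univ.exists_isMaxOn ⟨⟨0, zero_mem_cube d⟩, mem_univ _⟩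
    f.continuous.continuousOn
  have hmaj : Majorizes 0 (f z) f := fun y => by simpa using hz (mem_univ y)
  exact ⟨z, hmaj.mem_contactSet (by simp)⟩

namespace Typical

section

variable {d : ℕ} {f : C(cube d, ℝ)} {x : Space d}

theorem contDiffOn (H : Typical f) : ContDiffOn ℝ 1 (envelope 1 f) (openCube d) :=
  contDiffOn_envelope H.steep H.wedgeFree

theorem holderExponent_eq_zero (H : Typical f) (hx : x ∈ cube d \ openCube d) :
    holderExponent (envelope 1 f) x = 0 := by
  obtain ⟨j, a, ha, hxa⟩ := exists_mem_face_of_notMem_openCube hx.1 hx.2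
  exact holderExponent_envelope_eq_zero ha (H.steep a ha j) hxa

theorem holderExponent_of_mem_frontier (H : Typical f) (hx : x ∈ frontier (cube d)) :
    holderExponent (envelope 1 f) x = 0 :=
  H.holderExponent_eq_zero (frontier_cube_subset d hx)

theorem holderExponent_eq_one (H : Typical f) (hx : x ∈ openCube d) (hridge : IsRidgePoint f x) :
    holderExponent (envelope 1 f) x = 1 :=
  (holderExponent_envelope_le_one hx hridge H.sharpRidges).antisymm <| one_le_holderExponent <|
    (H.contDiffOn.differentiableOn one_ne_zero).differentiableAt ((isOpen_openCube d).mem_nhds hx)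

theorem holderExponent_trichotomy (H : Typical f) (hx : x ∈ cube d) :
    x ∈ cube d \ openCube d ∧ holderExponent (envelope 1 f) x = 0 ∨
      IsRidgePoint f x ∧ x ∈ openCube d ∧ holderExponent (envelope 1 f) x = 1 ∨
      x ∈ openCube d ∧ holderExponent (envelope 1 f) x = ⊤ := by
  by_cases hxo : x ∈ openCube d
  · rcases eventually_envelope_eq_or_isRidgePoint (f := f) hxo with ⟨p, c, hpc⟩ | hridge
    · exact Or.inr (Or.inr ⟨hxo, holderExponent_eq_top_of_affine hpc⟩)
    · exact Or.inr (Or.inl ⟨hridge, hxo, H.holderExponent_eq_one hxo hridge⟩)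
  · exact Or.inl ⟨⟨hx, hxo⟩, H.holderExponent_eq_zero ⟨hx, hxo⟩⟩

theorem holderLevelSet_zero (H : Typical f) :
    holderLevelSet (envelope 1 f) 0 = cube d \ openCube d := by
  refine Subset.antisymm ?_ fun x hx => ⟨hx.1, H.holderExponent_eq_zero hx⟩
  rintro x ⟨hx, h0⟩
  rcases H.holderExponent_trichotomy hx with ⟨hxo, -⟩ | ⟨-, -, h1⟩ | ⟨-, h1⟩
  · exact hxo
  · simp [h0] at h1
  · simp [h0] at h1

theorem holderLevelSet_zero_inter_openCube (H : Typical f) :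
    holderLevelSet (envelope 1 f) 0 ∩ openCube d = ∅ := by
  rw [H.holderLevelSet_zero, sdiff_inter_self]

theorem holderLevelSet_one_subset (H : Typical f) :
    holderLevelSet (envelope 1 f) 1 ⊆ {x | IsRidgePoint f x} := by
  rintro x ⟨hx, h1⟩
  rcases H.holderExponent_trichotomy hx with ⟨-, h0⟩ | ⟨hridge, -⟩ | ⟨-, htop⟩
  · simp [h1] at h0
  · exact hridge
  · simp [h1] at htop

theorem holderLevelSet_eq_empty (H : Typical f) {h : ℝ≥0∞} (h0 : 0 < h) (htop : h < ⊤)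
    (h1 : h ≠ 1) : holderLevelSet (envelope 1 f) h = ∅ := by
  refine eq_empty_of_forall_notMem ?_
  rintro x ⟨hx, rfl⟩
  rcases H.holderExponent_trichotomy hx with ⟨-, hx0⟩ | ⟨-, -, hx1⟩ | ⟨-, hxtop⟩
  · exact h0.ne' hx0
  · exact h1 hx1
  · exact htop.ne hxtop

theorem spectrumHolder_eq_bot (H : Typical f) {h : ℝ≥0∞} (h0 : 0 < h) (htop : h < ⊤)
    (h1 : h ≠ 1) : spectrumHolder (envelope 1 f) h = ⊥ := by
  rw [spectrumHolder, H.holderLevelSet_eq_empty h0 htop h1, hausdorffDim, if_pos rfl]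

theorem hasRightPartial {j : Fin d} (H : Typical f) (hx : x ∈ face 0 j) :
    HasRightPartial (envelope 1 f) j x ⊤ :=
  hasRightPartial_envelope (H.steep 0 (Or.inl rfl) j) hx

theorem hasLeftPartial {j : Fin d} (H : Typical f) (hx : x ∈ face 1 j) :
    HasLeftPartial (envelope 1 f) j x ⊥ :=
  hasLeftPartial_envelope (H.steep 1 (Or.inr rfl) j) hx

theorem hausdorffDim_contactSet (H : Typical f) : hausdorffDim (contactSet 1 f) = 0 := by
  simpa using hausdorffDim_eq_natCast (k := 0) (contactSet_one_nonempty f)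
    (by simpa using dimH_contactSet H.thinContact)

end

section

variable {m : ℕ} {f : C(cube (m + 1), ℝ)}

theorem spectrumHolder_zero (H : Typical f) :
    spectrumHolder (envelope 1 f) 0 = ((m : ℝ) : EReal) := by
  rw [spectrumHolder, H.holderLevelSet_zero]
  refine hausdorffDim_eq_of_openCube_subset_dropFirst (fun v hv => ?_)
    (dimH_cube_diff_openCube_le m)
  obtain ⟨x, hx, hxv⟩ := exists_mem_face_dropFirst_eq hv
  exact ⟨x, ⟨hx.1, fun hxo => (hxo 0).1.ne' hx.2⟩, hxv⟩

theorem spectrumHolder_one (H : Typical f) :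
    spectrumHolder (envelope 1 f) 1 = ((m : ℝ) : EReal) := by
  refine hausdorffDim_eq_of_openCube_subset_dropFirst (fun v hv => ?_)
    ((dimH_mono H.holderLevelSet_one_subset).trans (dimH_setOf_isRidgePoint_le H.thinContact))
  obtain ⟨x, hx, rfl⟩ := exists_mem_face_dropFirst_eq hv
  obtain ⟨t, ht, haffine⟩ := exists_not_locally_affine_on_line (H.steep 0 (Or.inl rfl) 0) hx
  have hxo := inward_mem_openCube ht hx hv
  exact ⟨inward 0 0 t x, ⟨openCube_subset_cube _ hxo, H.holderExponent_eq_one hxo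
    ((eventually_envelope_eq_or_isRidgePoint hxo).resolve_left haffine)⟩, dropFirst_inward 0 t x⟩

theorem spectrumHolder_top (H : Typical f) :
    spectrumHolder (envelope 1 f) ⊤ = (((m + 1 : ℕ) : ℝ) : EReal) := by
  have hcover : openCube (m + 1) ⊆ holderLevelSet (envelope 1 f) ⊤ ∪ {x | IsRidgePoint f x} := by
    intro x hx
    rcases eventually_envelope_eq_or_isRidgePoint (f := f) hx with ⟨p, c, hpc⟩ | hridge
    · exact Or.inl ⟨openCube_subset_cube _ hx, holderExponent_eq_top_of_affine hpc⟩
    · exact Or.inr hridge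
  have hridge : dimH {x | IsRidgePoint f x} < (m + 1 : ℕ) :=
    (dimH_setOf_isRidgePoint_le H.thinContact).trans_lt (by exact_mod_cast m.lt_succ_self)
  have hge : ((m + 1 : ℕ) : ℝ≥0∞) ≤ dimH (holderLevelSet (envelope 1 f) ⊤) := by
    have hle := dimH_mono hcover
    rw [dimH_openCube, dimH_union] at hle
    exact (le_max_iff.1 hle).resolve_right hridge.not_ge
  have hle : dimH (holderLevelSet (envelope 1 f) ⊤) ≤ (m + 1 : ℕ) := by
    refine (dimH_mono (subset_univ _)).trans_eq ?_
    rw [Real.dimH_univ_eq_finrank, finrank_euclideanSpace_fin]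
  refine hausdorffDim_eq_natCast (nonempty_iff_ne_empty.2 fun h => ?_) (hle.antisymm hge)
  simp [h] at hge

end

end Typical

/-! ### The lower envelope -/

section Neg

variable {d : ℕ} {f : C(cube d, ℝ)} {φ : Space d → ℝ} {j : Fin d} {x : Space d} {L : EReal}

theorem mk_neg_mem_graphHull_neg {y : ℝ} (h : (x, y) ∈ graphHull f) :
    (x, -y) ∈ graphHull (-f) := by
  let T : Space d × ℝ →ₗ[ℝ] Space d × ℝ := LinearMap.id.prodMap (-LinearMap.id)
  have := mem_image_of_mem T h
  rw [graphHull, T.image_convexHull, ← range_comp] at this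
  simpa [graphHull, T, Function.comp_def] using this

theorem envelope_two (f : C(cube d, ℝ)) : envelope 2 f = fun x => -envelope 1 (-f) x := by
  funext x
  have hneg : -{y | (x, y) ∈ graphHull f} = {y | (x, y) ∈ graphHull (-f)} := by
    ext y
    exact ⟨fun h => by simpa using mk_neg_mem_graphHull_neg (f := f) h,
      fun h => by simpa using mk_neg_mem_graphHull_neg (f := -f) h⟩
  rw [envelope_one, ← hneg, ← Real.sInf_def]
  simp [envelope]

theorem contactSet_two (f : C(cube d, ℝ)) : contactSet 2 f = contactSet 1 (-f) := by
  ext x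
  simp only [contactSet, envelope_two, mem_ofPred_eq, ContinuousMap.neg_apply, neg_eq_iff_eq_neg]

theorem MemHolderAt.neg {h : ℝ≥0} (H : MemHolderAt φ h x) :
    MemHolderAt (fun y => -φ y) h x := by
  obtain ⟨P, hP, C, hC⟩ := H
  refine ⟨-P, by rwa [MvPolynomial.totalDegree_neg], C, hC.mono fun y hy => ?_⟩
  rw [map_neg, ← neg_sub', abs_neg]
  exact hy

theorem holderExponent_neg (φ : Space d → ℝ) :
    holderExponent (fun y => -φ y) = holderExponent φ := by
  have hneg : ∀ h x, MemHolderAt (fun y => -φ y) h x ↔ MemHolderAt φ h x := fun h x =>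
    ⟨fun H => by simpa using H.neg, .neg⟩
  funext x
  simp only [holderExponent, hneg]

theorem holderLevelSet_neg (φ : Space d → ℝ) :
    holderLevelSet (fun y => -φ y) = holderLevelSet φ := by
  funext h
  simp only [holderLevelSet, holderExponent_neg]

theorem spectrumHolder_neg (φ : Space d → ℝ) :
    spectrumHolder (fun y => -φ y) = spectrumHolder φ := by
  funext h
  simp only [spectrumHolder, holderLevelSet_neg]

theorem HasRightPartial.neg (h : HasRightPartial φ j x L) :
    HasRightPartial (fun y => -φ y) j x (-L) := by
  refine ((continuous_neg.tendsto L).comp h).congr fun t => ?_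
  rw [Function.comp_apply, ← EReal.coe_neg, ← neg_div, neg_sub']

theorem HasLeftPartial.neg (h : HasLeftPartial φ j x L) :
    HasLeftPartial (fun y => -φ y) j x (-L) := by
  refine ((continuous_neg.tendsto L).comp h).congr fun t => ?_
  rw [Function.comp_apply, ← EReal.coe_neg, ← neg_div, neg_sub']

end Neg

end ConvexHullGraph

end

open ConvexHullGraph in
theorem theorem1 (d : ℕ) (hd : 1 ≤ d) :
    ∃ G : Set C(ConvexHullGraph.cube d, ℝ), Dense G ∧ IsGδ G ∧
      ∀ f ∈ G, ∀ i : ℕ, i = 1 ∨ i = 2 →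
        ContDiffOn ℝ 1 (ConvexHullGraph.envelope i f) (ConvexHullGraph.openCube d) ∧
        (∀ x ∈ frontier (ConvexHullGraph.cube d),
          ConvexHullGraph.holderExponent (ConvexHullGraph.envelope i f) x = 0) ∧
        ConvexHullGraph.spectrumHolder (ConvexHullGraph.envelope i f) 0
          = (((d : ℝ) - 1 : ℝ) : EReal) ∧
        ConvexHullGraph.holderLevelSet (ConvexHullGraph.envelope i f) 0
          ∩ ConvexHullGraph.openCube d = ∅ ∧
        ConvexHullGraph.spectrumHolder (ConvexHullGraph.envelope i f) 1
          = (((d : ℝ) - 1 : ℝ) : EReal) ∧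
        ConvexHullGraph.spectrumHolder (ConvexHullGraph.envelope i f) ⊤
          = ((d : ℝ) : EReal) ∧
        (∀ h : ℝ≥0∞, 0 < h → h < ⊤ → h ≠ 1 →
          ConvexHullGraph.spectrumHolder (ConvexHullGraph.envelope i f) h = ⊥ ∧
          ConvexHullGraph.holderLevelSet (ConvexHullGraph.envelope i f) h = ∅) ∧
        (∀ j : Fin d,
          (∀ x ∈ ConvexHullGraph.face 0 j,
            ConvexHullGraph.HasRightPartial (ConvexHullGraph.envelope i f) j x
              ((-1) ^ (i + 1) * ⊤)) ∧
          (∀ x ∈ ConvexHullGraph.face 1 j,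
            ConvexHullGraph.HasLeftPartial (ConvexHullGraph.envelope i f) j x
              ((-1) ^ i * ⊤))) ∧
        ConvexHullGraph.hausdorffDim (ConvexHullGraph.contactSet i f) = 0 := by
  obtain ⟨m, rfl⟩ := Nat.exists_eq_add_of_le' hd
  obtain ⟨G, hGsub, hGδ, hGd⟩ := mem_residual.1
    (inter_mem (typical_mem_residual hd) (typical_neg_mem_residual hd))
  have hm : ((((m + 1 : ℕ) : ℝ) - 1 : ℝ) : EReal) = ((m : ℝ) : EReal) := by
    rw [Nat.cast_add_one, add_sub_cancel_right]
  refine ⟨G, hGd, hGδ, fun f hf i hi => ?_⟩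
  obtain ⟨H₁, H₂⟩ : Typical f ∧ Typical (-f) := hGsub hf
  rw [hm]
  rcases hi with rfl | rfl
  · exact ⟨H₁.contDiffOn, fun _ => H₁.holderExponent_of_mem_frontier,
      H₁.spectrumHolder_zero, H₁.holderLevelSet_zero_inter_openCube, H₁.spectrumHolder_one,
      H₁.spectrumHolder_top, fun h h0 htop h1 =>
        ⟨H₁.spectrumHolder_eq_bot h0 htop h1, H₁.holderLevelSet_eq_empty h0 htop h1⟩,
      fun j => ⟨fun x hx => by simpa using H₁.hasRightPartial hx,
        fun x hx => by simpa using H₁.hasLeftPartial hx⟩,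
      H₁.hausdorffDim_contactSet⟩
  · rw [envelope_two, holderExponent_neg, spectrumHolder_neg, holderLevelSet_neg, contactSet_two]
    exact ⟨H₂.contDiffOn.neg, fun _ => H₂.holderExponent_of_mem_frontier,
      H₂.spectrumHolder_zero, H₂.holderLevelSet_zero_inter_openCube, H₂.spectrumHolder_one,
      H₂.spectrumHolder_top, fun h h0 htop h1 =>
        ⟨H₂.spectrumHolder_eq_bot h0 htop h1, H₂.holderLevelSet_eq_empty h0 htop h1⟩,
      fun j => ⟨fun x hx => by simpa [pow_succ] using (H₂.hasRightPartial hx).neg,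
        fun x hx => by simpa using (H₂.hasLeftPartial hx).neg⟩,
      H₂.hausdorffDim_contactSet⟩
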